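/- For a finite ranked poset $P$ of length $\ell$ with minimum $\hat 0$, let $\chi_P(t)=\sum_{x\in P}\mu_P(\hat 0,x)\,t^{\ell-\mathrm{rk}(x)}$ be its characteristic polynomial. For a finite set $V$ of positive integers, let $\Gamma_V$ be the graph on $V$ in which $u<v$ are adjacent if and only if $u$ is odd and $v$ is even, and let $\Pi_{\Gamma_V}$ be its bond lattice: the set of partitions of $V$ all of whose blocks induce connected subgraphs of $\Gamma_V$, ordered so that $\pi\le\pi'$ when $\pi$ refines $\pi'$ (the minimum is the partition into singletons). Write $\Gamma_{2n}=\Gamma_{\{1,\dots,2n\}}$. For $n\ge 3$ let $V_n=\{1,\dots,2n\}\setminus\{2,2n-1\}$, let $$L_{2n}=\{\pi\in\Pi_{\Gamma_{V_n}} : 1\text{ and }2n\text{ are in distinct blocks of }\pi\}$$ with the induced order, and let $\mathcal P_{2n}$ be the affine hyperplane arrangement in the affine space $E=\{x\in\mathbb R^{V_n} : x_1=x_{2n}+1\}$ that consists of the nonempty intersections with $E$ of the hyperplanes $x_i=x_j$, $\{i,j\}$ an edge of $\Gamma_{V_n}$. Its regions are the connected components of the complement in $E$ of the union of its hyperplanes.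 A region is called bounded if it is relatively bounded, that is, contained in the sum of a bounded set and the lineality space of $\mathcal P_{2n}$ (the space of vectors parallel to $E$ and to all hyperplanes of $\mathcal P_{2n}$). A Dumont permutation on $\{1,\dots,2m\}$ is a permutation $\sigma$ with $\sigma(2i)<2i$ and $\sigma(2i-1)\ge 2i-1$ for $1\le i\le m$. Let $g_n$ ($n\ge1$, Genocchi number) be the number of Dumont permutations on $\{1,\dots,2n-2\}$, and let $h_n$ ($n\ge 0$, median Genocchi number) be the number of Dumont permutations without fixed points on $\{1,\dots,2n+2\}$. Then for all $n\ge 3$, $$(t-1)^3\,\chi_{L_{2n}}(t)=\chi_{\Pi_{\Gamma_{2n}}}(t),\qquad \chi_{L_{2n}}(0)=g_n,\qquad \chi_{L_{2n}}(1)=h_{n-3},$$ and the number of bounded regions of $\mathcal P_{2n}$ is $h_{n-3}$. -/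

import Mathlib

noncomputable section

namespace HomLinial

/-! ### Characteristic polynomial of a finite ranked poset with minimum -/

section CharPoly

variable (P : Type*) [PartialOrder P]

/-- The rank of `x`: the largest `m` such that there is a chain `x₀ < x₁ < ⋯ < xₘ = x`. -/
def rk {P : Type*} [PartialOrder P] (x : P) : ℕ := (Order.height x).toNat

open Classical in
/-- The Möbius function of a finite poset, with integer values. -/
def moebius {P : Type*} [PartialOrder P] [Finite P] (x y : P) : ℤ :=
  letI : Fintype P := Fintype.ofFinite P
  letI : LocallyFiniteOrder P := Fintype.toLocallyFiniteOrder
  IncidenceAlgebra.mu ℤ x y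

/-- The length of a finite poset: the largest rank of an element. -/
def length [Finite P] : ℕ :=
  letI : Fintype P := Fintype.ofFinite P
  Finset.univ.sup (fun x : P => rk x)

open Polynomial in
/-- `χ_P(t) = ∑ₓ μ(0̂, x) t ^ (ℓ - rk x)`, where `ℓ` is the length of `P`. -/
def charPoly [Finite P] [OrderBot P] : ℤ[X] :=
  letI : Fintype P := Fintype.ofFinite P
  ∑ x : P, C (moebius ⊥ x) * X ^ (length P - rk x)

end CharPoly

/-! ### Bond lattices -/

instance finiteSetoid {V : Type*} [Finite V] : Finite (Setoid V) :=
  Finite.of_injective (fun s : Setoid V => fun a b => s a b)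
    (fun _ _ h => Setoid.ext fun a b => iff_of_eq (congrFun (congrFun h a) b))

/-- The bond lattice of `G`: the partitions of the vertex set (as equivalence relations, ordered
by inclusion, so that `⊥` is the partition into singletons) all of whose blocks induce connected
subgraphs. -/
abbrev BondLattice {V : Type*} (G : SimpleGraph V) : Type _ :=
  {π : Setoid V // ∀ B ∈ π.classes, (G.induce B).Connected}

theorem bot_mem_bondLattice {V : Type*} (G : SimpleGraph V) :
    ∀ B ∈ (⊥ : Setoid V).classes, (G.induce B).Connected := by
  rintro B ⟨y, rfl⟩
  have hs : Subsingleton ({x | (⊥ : Setoid V) x y} : Set V) :=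
    ⟨fun a b => Subtype.ext ((show a.1 = y from a.2).trans (show b.1 = y from b.2).symm)⟩
  have hne : Nonempty ({x | (⊥ : Setoid V) x y} : Set V) := ⟨⟨y, rfl⟩⟩
  exact { preconnected := fun a b => by rw [Subsingleton.elim a b], nonempty := hne }

instance {V : Type*} (G : SimpleGraph V) : OrderBot (BondLattice G) where
  bot := ⟨⊥, bot_mem_bondLattice G⟩
  bot_le π := (bot_le : (⊥ : Setoid V) ≤ π.1)

/-! ### The graphs `Γ_V` and the semilattice `L_{2n}` -/

/-- The graph `Γ_V`: `u < v` are adjacent exactly when `u` is odd and `v` is even. -/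
def Gam (V : Finset ℕ) : SimpleGraph V where
  Adj u v := (u.1 < v.1 ∧ Odd u.1 ∧ Even v.1) ∨ (v.1 < u.1 ∧ Odd v.1 ∧ Even u.1)
  symm := ⟨fun _ _ h => h.symm⟩
  loopless := ⟨fun _ h => by rcases h with h | h <;> exact lt_irrefl _ h.1⟩

/-- The set `[2n] \ {2, 2n-1}`. -/
def redVerts (n : ℕ) : Finset ℕ := Finset.Icc 1 (2 * n) \ {2, 2 * n - 1}

/-- The vertex `1` of `[2n] \ {2, 2n-1}`. -/
def vFirst (n : ℕ) (hn : 2 ≤ n) : redVerts n :=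
  ⟨1, by simp only [redVerts, Finset.mem_sdiff, Finset.mem_Icc, Finset.mem_insert,
    Finset.mem_singleton]; omega⟩

/-- The vertex `2n` of `[2n] \ {2, 2n-1}`. -/
def vLast (n : ℕ) (hn : 2 ≤ n) : redVerts n :=
  ⟨2 * n, by simp only [redVerts, Finset.mem_sdiff, Finset.mem_Icc, Finset.mem_insert,
    Finset.mem_singleton]; omega⟩

/-- `L_{2n}`: the elements of the bond lattice of `Γ_{[2n] \ {2, 2n-1}}` in which `1` and `2n` lie
in distinct blocks, with the induced order. -/
abbrev L (n : ℕ) (hn : 2 ≤ n) : Type :=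
  {π : BondLattice (Gam (redVerts n)) // ¬ π.1 (vFirst n hn) (vLast n hn)}

instance (n : ℕ) (hn : 2 ≤ n) : OrderBot (L n hn) where
  bot := ⟨⊥, fun h => by
    have h1 : vFirst n hn = vLast n hn := h
    have h2 : 1 = 2 * n := congrArg Subtype.val h1
    omega⟩
  bot_le π := (bot_le : (⊥ : BondLattice (Gam (redVerts n))) ≤ π.1)

/-! ### Affine arrangements and their regions -/

section Arrangement

variable {V : Type*}

/-- The affine hyperplane `x_i - x_j = c` (for `i ≠ j`) in `ℝ^V`. -/
def diffHyperplane (i j : V) (c : ℝ) : AffineSubspace ℝ (V → ℝ) where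
  carrier := {x | x i - x j = c}
  smul_vsub_vadd_mem' := by
    intro t p q r hp hq hr
    simp only [Set.mem_ofPred_eq, vsub_eq_sub, vadd_eq_add, Pi.add_apply, Pi.smul_apply,
      Pi.sub_apply, smul_eq_mul] at *
    linear_combination t * hp - t * hq + hr

/-- The graphic arrangement `{x_i = x_j : {i, j} ∈ E(G)}` in `ℝ^V`. -/
def graphicArrangement (G : SimpleGraph V) : Set (AffineSubspace ℝ (V → ℝ)) :=
  {H | ∃ i j, G.Adj i j ∧ H = diffHyperplane i j 0}

/-- The traces on `E` of those members of the arrangement `A` that meet `E`. -/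
def restrictTo (A : Set (AffineSubspace ℝ (V → ℝ))) (E : AffineSubspace ℝ (V → ℝ)) :
    Set (AffineSubspace ℝ (V → ℝ)) :=
  {K | K ≠ ⊥ ∧ ∃ H ∈ A, K = H ⊓ E}

/-- The complement in the ambient affine space `E` of the union of the arrangement `A`. -/
def complement (E : AffineSubspace ℝ (V → ℝ)) (A : Set (AffineSubspace ℝ (V → ℝ))) :
    Set (V → ℝ) :=
  {x | x ∈ E ∧ ∀ H ∈ A, x ∉ H}

/-- The regions of the arrangement `A` in `E`: the connected components of the complement. -/
def regions (E : AffineSubspace ℝ (V → ℝ)) (A : Set (AffineSubspace ℝ (V → ℝ))) :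
    Set (Set (V → ℝ)) :=
  {R | ∃ x ∈ complement E A, R = connectedComponentIn (complement E A) x}

/-- The lineality space of the arrangement `A` in `E`: the vectors parallel to `E` and to all
hyperplanes of `A`. -/
def lineality (E : AffineSubspace ℝ (V → ℝ)) (A : Set (AffineSubspace ℝ (V → ℝ))) :
    Submodule ℝ (V → ℝ) :=
  E.direction ⊓ ⨅ H ∈ A, H.direction

/-- `R` is bounded modulo the lineality space of the arrangement. Every region is invariant under
translation by the lineality space, and this is boundedness of the corresponding region of the
essentialized arrangement (for an essential arrangement it is ordinary boundedness). -/
def RelativelyBounded [Finite V] (E : AffineSubspace ℝ (V → ℝ))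
    (A : Set (AffineSubspace ℝ (V → ℝ))) (R : Set (V → ℝ)) : Prop :=
  letI : Fintype V := Fintype.ofFinite V
  ∃ B : Set (V → ℝ), Bornology.IsBounded B ∧
    ∀ x ∈ R, ∃ b ∈ B, x - b ∈ lineality E A

/-- The bounded regions of the arrangement `A` in `E` (modulo its lineality space). -/
def boundedRegions [Finite V] (E : AffineSubspace ℝ (V → ℝ))
    (A : Set (AffineSubspace ℝ (V → ℝ))) : Set (Set (V → ℝ)) :=
  {R | R ∈ regions E A ∧ RelativelyBounded E A R}

end Arrangement

/-- The affine hyperplane `x_1 = x_{2n} + 1`. -/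
def slice (n : ℕ) (hn : 2 ≤ n) : AffineSubspace ℝ (redVerts n → ℝ) :=
  diffHyperplane (vFirst n hn) (vLast n hn) 1

/-- The affine arrangement `𝒫_{2n}`: the graphic arrangement of `Γ_{[2n] \ {2, 2n-1}}` intersected
with the affine hyperplane `x_1 = x_{2n} + 1`. -/
def arrP (n : ℕ) (hn : 2 ≤ n) : Set (AffineSubspace ℝ (redVerts n → ℝ)) :=
  restrictTo (graphicArrangement (Gam (redVerts n))) (slice n hn)

/-! ### Genocchi and median Genocchi numbers -/

/-- Dumont permutations on `[2m]`: `2i > σ(2i)` and `2i - 1 ≤ σ(2i - 1)` for `1 ≤ i ≤ m`. -/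
def IsDumont {m : ℕ} (σ : Equiv.Perm (Finset.Icc 1 (2 * m))) : Prop :=
  ∀ i, (Even i.1 → (σ i).1 < i.1) ∧ (Odd i.1 → i.1 ≤ (σ i).1)

/-- The Genocchi number `g_n` (`n ≥ 1`): the number of Dumont permutations on `[2n-2]`. -/
def genocchi (n : ℕ) : ℕ :=
  Nat.card {σ : Equiv.Perm (Finset.Icc 1 (2 * (n - 1))) // IsDumont σ}

/-- The median Genocchi number `h_n` (`n ≥ 0`): the number of Dumont derangements (Dumont
permutations without fixed points) on `[2n+2]`. -/
def medianGenocchi (n : ℕ) : ℕ :=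
  Nat.card {σ : Equiv.Perm (Finset.Icc 1 (2 * (n + 1))) // IsDumont σ ∧ ∀ i, σ i ≠ i}

end HomLinial

end

/-!
Everything reduces to one recursion. For a sequence `φ` put
`R φ k = k (T - k) φ(k) + (T - k - ν) (T - k - 1) φ(k + 1)` (`roundOp T ν`). All the quantities in
question are values at `1` of iterates of `R` on the constant sequence `1`.

*Characteristic polynomials.* Möbius inversion over bonds shows that the characteristic polynomial
of the bond lattice of `Γ_{2n}` at `t` counts the proper `t`-colourings with a given colour at `1`,
and that of `L_{2n}` those of the reduced graph with given distinct colours at `1` and `2n`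
(`eval_charPoly_of_separating`). The vertices of `Γ_V` can be coloured in increasing order, since
an odd vertex has no smaller neighbour and an even one is adjacent to all smaller odd ones; only the
number `k` of colours in use on the odd vertices matters, and a pair of vertices `2i+3, 2i+4`
contributes one application of `R`. This gives `(t - 1) R^(n-1) 1` with `ν = 0` for the full graph
and `R^(n-2) 1` with `ν = 1` for the reduced one (where `ν` stands for the colour of `2n`).
Multiplication by `T - k` intertwines the two operators, whence the factor `(t - 1)^3`.

*Genocchi numbers.* The condition at an odd position of a Dumont permutation is the complement of an
initial interval, and the condition at an even position is an initial interval. Replacing each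
complement by a difference leaves nested conditions, which are counted greedily; the resulting
recursion is `R` at `T = 0`, `ν = 1` for Dumont permutations and at `T = 1`, `ν = 1` for those
without fixed points (`genocchi_add_two`, `medianGenocchi_eq`).

*Bounded regions.* The elimination of vertices only uses that summation over the colours is linear
and gives a point mass `1` and the whole set mass `T` (`IsIntegral`). Integration over `ℝ` with
respect to the Euler characteristic for which open bounded intervals have measure `-1` and open
rays `0` has the same properties with `T = 1`. So the iterated integral of the indicator function
of the complement of the graphic arrangement, over all coordinates but `x_1 = 1` and `x_{2n} = 0`,
is `R^(n-2) 1` at `T = 1`. That indicator function is the sum of those of the regions, which are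
the cones of certain strict partial orders. Integrating a coordinate out of such a cone gives the
cone of the induced order up to the sign `-1` if the coordinate is bounded on both sides, and `0` if
it is bounded on one side only. Hence a region contributes `(-1)^(2n-4) = 1` if all its coordinates
lie between those of `2n` and of `1`, and `0` otherwise (`card_regionOrders_between`), and the
former are the bounded regions (`relativelyBounded_iff`).
-/

noncomputable section

namespace HomLinial

open Finset

/-! ### The recursion satisfied by the characteristic polynomials -/

/-- The operator on sequences `φ : ℕ → A` describing one odd and one even vertex in the count of
proper colourings of a graph `Γ_V` with `T` colours: if `k` colours are in use on the odd vertices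
so far, and `ν` further colours are forbidden for odd vertices, then the next odd vertex either
repeats one of the `k` colours or takes one of `T - k - ν` new ones, and the even vertex after it
avoids all colours of the odd ones. -/
def roundOp {A : Type*} [CommRing A] (T ν : A) (φ : ℕ → A) (k : ℕ) : A :=
  k * ((T - k) * φ k) + (T - k - ν) * ((T - k - 1) * φ (k + 1))

theorem map_iterate_roundOp {A B : Type*} [CommRing A] [CommRing B] (f : A →+* B) (T ν : A)
    (m k : ℕ) :
    f ((roundOp T ν)^[m] (fun _ => 1) k) = (roundOp (f T) (f ν))^[m] (fun _ => 1) k := by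
  induction m generalizing k with
  | zero => simp
  | succ m ih => simp [Function.iterate_succ_apply', roundOp, ih]

/-- Multiplication by `T - k` intertwines `roundOp T 1` and `roundOp T 0`. -/
theorem iterate_roundOp_zero_mul {A : Type*} [CommRing A] (T : A) (m : ℕ) (φ : ℕ → A) (k : ℕ) :
    (roundOp T 0)^[m] (fun k => (T - k) * φ k) k = (T - k) * (roundOp T 1)^[m] φ k := by
  induction m generalizing k with
  | zero => simp
  | succ m ih =>
    simp only [Function.iterate_succ_apply', roundOp, ih]
    push_cast
    ring

theorem iterate_succ_roundOp_zero_one {A : Type*} [CommRing A] (T : A) (m : ℕ) :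
    (roundOp T 0)^[m + 1] (fun _ => 1) 1 = (T - 1) ^ 2 * (roundOp T 1)^[m] (fun _ => 1) 1 := by
  have h : roundOp T 0 (fun _ => 1) = fun k : ℕ => (T - k) * (T - 1) := by
    funext k
    simp only [roundOp]
    ring
  have h2 : ∀ k, (roundOp T 1)^[m] (fun _ => T - 1) k
      = (T - 1) * (roundOp T 1)^[m] (fun _ => 1) k := by
    clear h
    induction m with
    | zero => simp
    | succ m ih =>
      intro k
      simp only [Function.iterate_succ_apply', roundOp, ih]
      ring
  rw [Function.iterate_succ_apply, h, iterate_roundOp_zero_mul, h2]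
  push_cast
  ring

/-! ### Counting permutations with restricted positions -/

section Choices

variable {α : Type*} [DecidableEq α]

/-- The number of ways to choose pairwise distinct elements outside `U`, one from each member of
the list `l`. -/
def choices : List (Finset α) → Finset α → ℤ
  | [], _ => 1
  | S :: l, U => ∑ x ∈ S \ U, choices l (insert x U)

theorem choices_perm {l l' : List (Finset α)} (h : l.Perm l') (U : Finset α) :
    choices l U = choices l' U := by
  induction h generalizing U with
  | nil => rfl
  | cons S _ ih => exact sum_congr rfl fun x _ => ih _
  | swap S S' l =>
    simp only [choices]
    rw [sum_comm' (t' := S \ U) (s' := fun y => S' \ insert y U)]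
    · exact sum_congr rfl fun y _ => sum_congr rfl fun x _ => by rw [insert_comm]
    · intro x y
      simp only [mem_sdiff, mem_insert]
      grind
  | trans _ _ ih1 ih2 => rw [ih1, ih2]

theorem choices_sdiff_cons {W B : Finset α} (h : B ⊆ W) (l : List (Finset α)) (U : Finset α) :
    choices ((W \ B) :: l) U = choices (W :: l) U - choices (B :: l) U := by
  simp only [choices]
  rw [eq_sub_iff_add_eq, ← sum_union]
  · congr 1
    grind
  · rw [disjoint_left]
    grind

theorem choices_cons_of_forall {S : Finset α} {l : List (Finset α)} {U : Finset α} {c : ℤ}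
    (h : ∀ x ∈ S \ U, choices l (insert x U) = c) : choices (S :: l) U = #(S \ U) * c := by
  simp only [choices]
  rw [sum_congr rfl h, sum_const, nsmul_eq_mul]

theorem choices_replicate (W : Finset α) (j : ℕ) (U : Finset α) (h : #(W \ U) = j) :
    choices (List.replicate j W) U = (j.factorial : ℤ) := by
  induction j generalizing U with
  | zero => simp [choices]
  | succ j ih =>
    rw [List.replicate_succ, choices_cons_of_forall (c := (j.factorial : ℤ)), h,
      Nat.factorial_succ]
    · push_cast; ring
    · intro x hx
      apply ih
      rw [sdiff_insert, card_erase_of_mem hx, h]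
      rfl

theorem choices_ofFn {n : ℕ} (A : Fin n → Finset α) (U : Finset α) :
    choices (List.ofFn A) U =
      #{f ∈ Fintype.piFinset A | Function.Injective f ∧ ∀ i, f i ∉ U} := by
  induction n generalizing U with
  | zero =>
    simp only [List.ofFn_zero, choices]
    rw [filter_true_of_mem]
    · simp
    · exact fun f _ => ⟨fun a => a.elim0, fun a => a.elim0⟩
  | succ n ih =>
    rw [List.ofFn_succ]
    simp only [choices, ih]
    rw [card_eq_sum_card_fiberwise (f := fun f => f 0) (t := A 0 \ U)]
    · push_cast
      refine sum_congr rfl fun x hx => ?_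
      rw [mem_sdiff] at hx
      congr 1
      refine card_bij (fun f _ => (Fin.cons x f : Fin (n + 1) → α)) ?_ ?_ ?_
      · intro f hf
        simp only [mem_filter, Fintype.mem_piFinset, mem_insert, not_or] at hf ⊢
        refine ⟨⟨fun i => ?_, ?_, fun i => ?_⟩, rfl⟩
        · refine Fin.cases ?_ (fun i => ?_) i
          · exact hx.1
          · exact hf.1 i
        · rw [Fin.cons_injective_iff]
          refine ⟨?_, hf.2.1⟩
          rintro ⟨i, hi⟩
          exact (hf.2.2 i).1 hi
        · refine Fin.cases ?_ (fun i => ?_) i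
          · exact hx.2
          · exact (hf.2.2 i).2
      · intro f _ g _ hfg
        exact (Fin.cons_injective2 hfg).2
      · intro f hf
        simp only [mem_filter, Fintype.mem_piFinset] at hf
        obtain ⟨⟨h1, h2, h3⟩, rfl⟩ := hf
        refine ⟨Fin.tail f, ?_, Fin.cons_self_tail f⟩
        simp only [mem_filter, Fintype.mem_piFinset, mem_insert, not_or]
        exact ⟨fun i => h1 _, fun a b hab => Fin.succ_injective _ (h2 hab),
          fun i => ⟨fun h => Fin.succ_ne_zero i (h2 h), h3 _⟩⟩
    · intro f hf
      simp only [coe_filter, Set.mem_ofPred_eq, Fintype.mem_piFinset] at hf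
      simp only [coe_sdiff, Set.mem_sdiff, mem_coe]
      exact ⟨hf.1 0, hf.2.2 0⟩

end Choices

/-! ### Dumont permutations -/

/-- The values allowed at the position `p + 1` of a Dumont permutation of `[2M]` (if `d = 0`), or
of one without fixed points (if `d = 1`). -/
def dumontValues (d M p : ℕ) : Finset ℕ :=
  if Even p then Icc 1 (2 * M) \ Icc 1 (p + d) else Icc 1 p

/-- The step of the recursion for Dumont permutations; the argument counts the positions whose
value is not restricted any more. -/
def dumontOp (d : ℕ) (ψ : ℕ → ℤ) (j : ℕ) : ℤ :=
  (j + 1) ^ 2 * ψ (j + 1) - j * (j + d) * ψ j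

/-- The restriction at an odd position is the complement of an initial interval, so the count is
the difference of two counts: in the first the position is unrestricted and can be dealt with at
the very end, in the second it takes one of the small values. -/
theorem choices_dumontValues {d M : ℕ} (hd : d ≤ 1) (r i j : ℕ) (hr : i + r = M) (U : Finset ℕ)
    (hU : U ⊆ Icc 1 (2 * i)) (hj : #(Icc 1 (2 * i) \ U) = j) :
    choices (List.replicate j (Icc 1 (2 * M)) ++
        (List.range' (2 * i) (2 * r)).map (dumontValues d M)) U =
      j.factorial * (dumontOp d)^[r] (fun _ => 1) j := by
  induction r generalizing i j U with
  | zero =>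
    obtain rfl : i = M := by omega
    simp [choices_replicate _ _ _ hj]
  | succ r ih =>
    have hcU : #U + j = 2 * i := by
      have h1 := card_sdiff_add_card_eq_card hU
      rw [hj, Nat.card_Icc] at h1
      omega
    have e1 : (List.range' (2 * i) (2 * (r + 1))).map (dumontValues d M) =
        (Icc 1 (2 * M) \ Icc 1 (2 * i + d)) :: Icc 1 (2 * i + 1) ::
          (List.range' (2 * (i + 1)) (2 * r)).map (dumontValues d M) := by
      rw [show 2 * (r + 1) = 2 * r + 1 + 1 by ring, List.range'_succ, List.range'_succ]
      simp [dumontValues, mul_add]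
    have hsub : ∀ N, 2 * i ≤ N → U ⊆ Icc 1 N := fun N hN =>
      hU.trans (Icc_subset_Icc_right hN)
    have hcard : ∀ N, 2 * i ≤ N → #(Icc 1 N \ U) = N - 2 * i + j := by
      intro N hN
      rw [card_sdiff_of_subset (hsub N hN), Nat.card_Icc]
      omega
    rw [e1, choices_perm (l' := (Icc 1 (2 * M) \ Icc 1 (2 * i + d)) :: Icc 1 (2 * i + 1) ::
          (List.replicate j (Icc 1 (2 * M)) ++
          (List.range' (2 * (i + 1)) (2 * r)).map (dumontValues d M))) (by
        refine List.perm_middle.trans (List.Perm.cons _ List.perm_middle)),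
      choices_sdiff_cons (Icc_subset_Icc_right (by omega))]
    -- The odd position becomes unrestricted; the even one takes one of `j + 1` values.
    have hA : choices (Icc 1 (2 * M) :: Icc 1 (2 * i + 1) ::
          (List.replicate j (Icc 1 (2 * M)) ++
          (List.range' (2 * (i + 1)) (2 * r)).map (dumontValues d M))) U =
        ((j + 1 : ℕ) : ℤ) * ((j + 1).factorial * (dumontOp d)^[r] (fun _ => 1) (j + 1)) := by
      rw [choices_perm (l' := Icc 1 (2 * i + 1) ::
          (List.replicate (j + 1) (Icc 1 (2 * M)) ++
          (List.range' (2 * (i + 1)) (2 * r)).map (dumontValues d M)))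
          (by rw [List.replicate_succ, List.cons_append]; exact List.Perm.swap _ _ _),
        choices_cons_of_forall (fun x hx => ih (i + 1) (j + 1) (by omega) (insert x U) ?_ ?_),
        hcard _ (by omega)]
      · congr 2; omega
      · rw [mem_sdiff, mem_Icc] at hx
        refine insert_subset ?_ (hsub _ (by omega))
        rw [mem_Icc]; omega
      · rw [mem_sdiff, mem_Icc] at hx
        rw [sdiff_insert, card_erase_of_mem, hcard _ (by omega)]
        · omega
        · rw [mem_sdiff, mem_Icc]; exact ⟨by omega, hx.2⟩
    -- The odd position takes one of `j + d` small values, after which `j` remain for the even one.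
    have hB : choices (Icc 1 (2 * i + d) :: Icc 1 (2 * i + 1) ::
          (List.replicate j (Icc 1 (2 * M)) ++
          (List.range' (2 * (i + 1)) (2 * r)).map (dumontValues d M))) U =
        ((j + d : ℕ) : ℤ) * ((j : ℤ) * (j.factorial * (dumontOp d)^[r] (fun _ => 1) j)) := by
      rw [choices_cons_of_forall (c := ((j : ℤ) * (j.factorial * (dumontOp d)^[r] (fun _ => 1) j))),
        hcard _ (by omega)]
      · congr 2; omega
      intro x hx
      rw [mem_sdiff, mem_Icc] at hx
      have hc2 : ∀ N, 2 * i + 1 ≤ N → #(Icc 1 N \ insert x U) = N - 2 * i + j - 1 := by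
        intro N hN
        rw [sdiff_insert, card_erase_of_mem, hcard _ (by omega)]
        rw [mem_sdiff, mem_Icc]; exact ⟨by omega, hx.2⟩
      rw [choices_cons_of_forall
        (fun y hy => ih (i + 1) j (by omega) (insert y (insert x U)) ?_ ?_), hc2 _ le_rfl]
      · congr 2; omega
      · rw [mem_sdiff, mem_Icc] at hy
        refine insert_subset ?_ (insert_subset ?_ (hsub _ (by omega)))
        · rw [mem_Icc]; omega
        · rw [mem_Icc]; omega
      · rw [mem_sdiff, mem_Icc] at hy
        rw [sdiff_insert, card_erase_of_mem, hc2 _ (by omega)]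
        · omega
        · rw [mem_sdiff, mem_Icc]; exact ⟨by omega, hy.2⟩
    rw [hA, hB, Function.iterate_succ_apply', dumontOp, Nat.factorial_succ]
    push_cast
    ring

theorem natCard_perm_dumontValues {d : ℕ} (hd : d ≤ 1) (M : ℕ) :
    (Nat.card {σ : Equiv.Perm (Icc 1 (2 * M)) //
      ∀ i, (σ i).1 ∈ dumontValues d M (i.1 - 1)} : ℤ) = (dumontOp d)^[M] (fun _ => 1) 0 := by
  have h := choices_dumontValues hd M 0 0 (zero_add M) ∅ (by simp) (by simp)
  have e : (List.range' (2 * 0) (2 * M)).map (dumontValues d M) =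
      List.ofFn (fun p : Fin (2 * M) => dumontValues d M p) :=
    List.ext_getElem (by simp) (by simp)
  rw [e, List.replicate_zero, List.nil_append, choices_ofFn, Nat.factorial_zero] at h
  rw [Nat.cast_one, one_mul] at h
  rw [← h, Nat.card_eq_fintype_card, Fintype.card_subtype]
  congr 1
  have hpos : ∀ p : Fin (2 * M), p.1 + 1 ∈ Icc 1 (2 * M) := fun p => by
    rw [mem_Icc]; omega
  have hval : ∀ p, ∀ x ∈ dumontValues d M p, p < 2 * M → x ∈ Icc 1 (2 * M) := by
    intro p x hx hp
    unfold dumontValues at hx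
    split_ifs at hx
    · exact (mem_sdiff.1 hx).1
    · rw [mem_Icc] at hx ⊢; omega
  refine card_bij (fun σ _ p => (σ ⟨p.1 + 1, hpos p⟩).1) ?_ ?_ ?_
  · intro σ hσ
    simp only [mem_filter, mem_univ, true_and, Fintype.mem_piFinset, notMem_empty,
      not_false_iff, implies_true, and_true] at hσ ⊢
    refine ⟨fun p => by simpa using hσ ⟨p.1 + 1, hpos p⟩, fun p q hpq => ?_⟩
    have := σ.injective (Subtype.ext hpq)
    rw [Subtype.mk.injEq] at this
    exact Fin.ext (by omega)
  · intro σ _ τ _ hst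
    refine Equiv.ext fun i => Subtype.ext ?_
    have hi := mem_Icc.1 i.2
    have := congrFun hst ⟨i.1 - 1, by omega⟩
    have hi' : (⟨i.1 - 1 + 1, hpos ⟨i.1 - 1, by omega⟩⟩ : Icc 1 (2 * M)) = i :=
      Subtype.ext (by simp; omega)
    simpa only [hi'] using this
  · intro f hf
    simp only [mem_filter, Fintype.mem_piFinset, notMem_empty, not_false_iff, implies_true,
      and_true] at hf
    have hlt : ∀ i : Icc 1 (2 * M), i.1 - 1 < 2 * M := fun i => by
      have hi := mem_Icc.1 i.2
      omega
    let g : Icc 1 (2 * M) → Icc 1 (2 * M) := fun i =>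
      ⟨f ⟨i.1 - 1, hlt i⟩, hval _ _ (hf.1 _) (hlt i)⟩
    have hg : Function.Injective g := by
      intro a b hab
      have h1 := hf.2 (congrArg Subtype.val hab)
      rw [Fin.mk.injEq] at h1
      have ha := mem_Icc.1 a.2
      have hb := mem_Icc.1 b.2
      exact Subtype.ext (by omega)
    refine ⟨Equiv.ofBijective g (Finite.injective_iff_bijective.1 hg), ?_, ?_⟩
    · simp only [mem_filter, mem_univ, true_and]
      exact fun i => hf.1 ⟨i.1 - 1, hlt i⟩
    · funext p
      simp [g]

theorem isDumont_iff {m : ℕ} (σ : Equiv.Perm (Icc 1 (2 * m))) :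
    IsDumont σ ↔ ∀ i, (σ i).1 ∈ dumontValues 0 m (i.1 - 1) := by
  refine forall_congr' fun i => ?_
  have hi := mem_Icc.1 i.2
  have hs := mem_Icc.1 (σ i).2
  unfold dumontValues
  rcases Nat.even_or_odd i.1 with h | h
  · have h' : ¬ Even (i.1 - 1) := by grind
    rw [if_neg h', mem_Icc]
    grind
  · have h' : Even (i.1 - 1) := by grind
    rw [if_pos h', mem_sdiff, mem_Icc, mem_Icc]
    grind

theorem isDumont_and_ne_iff {m : ℕ} (σ : Equiv.Perm (Icc 1 (2 * m))) :
    (IsDumont σ ∧ ∀ i, σ i ≠ i) ↔ ∀ i, (σ i).1 ∈ dumontValues 1 m (i.1 - 1) := by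
  unfold IsDumont
  rw [← forall_and]
  refine forall_congr' fun i => ?_
  have hi := mem_Icc.1 i.2
  have hs := mem_Icc.1 (σ i).2
  have hne : σ i ≠ i ↔ (σ i).1 ≠ i.1 := by rw [Ne, Subtype.ext_iff]
  rw [hne]
  unfold dumontValues
  rcases Nat.even_or_odd i.1 with h | h
  · have h' : ¬ Even (i.1 - 1) := by grind
    rw [if_neg h', mem_Icc]
    grind
  · have h' : Even (i.1 - 1) := by grind
    rw [if_pos h', mem_sdiff, mem_Icc, mem_Icc]
    grind

theorem genocchi_add_two (m : ℕ) :
    (genocchi (m + 2) : ℤ) = (roundOp (0 : ℤ) 1)^[m] (fun _ => 1) 1 := by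
  have h : dumontOp 0 = roundOp (0 : ℤ) 1 := by
    funext ψ j
    simp only [dumontOp, roundOp]
    push_cast
    ring
  have h2 := natCard_perm_dumontValues (d := 0) (by omega) (m + 1)
  rw [h, Function.iterate_succ_apply'] at h2
  have h3 : (genocchi (m + 2) : ℤ) = _ := (congrArg Nat.cast
    (Nat.card_congr (Equiv.subtypeEquivRight fun σ => isDumont_iff (m := m + 1) σ))).trans h2
  rw [h3]
  simp [roundOp]

theorem medianGenocchi_eq (m : ℕ) :
    (medianGenocchi m : ℤ) = (roundOp (1 : ℤ) 1)^[m + 1] (fun _ => 1) 1 := by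
  have h : ∀ r j, (dumontOp 1)^[r] (fun _ => 1) j
      = (roundOp (1 : ℤ) 1)^[r] (fun _ => 1) (j + 1) := by
    intro r
    induction r with
    | zero => simp
    | succ r ih =>
      intro j
      simp only [Function.iterate_succ_apply', dumontOp, roundOp, ih]
      push_cast
      ring
  have h2 := natCard_perm_dumontValues (d := 1) (by omega) (m + 1)
  rw [h] at h2
  exact (congrArg Nat.cast (Nat.card_congr
    (Equiv.subtypeEquivRight fun σ => isDumont_and_ne_iff (m := m + 1) σ))).trans h2

/-! ### Integrating out the vertices of a graph -/

section Integral

variable {K V : Type*}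

/-- The properties of an integral `H h e` ("`h : K → ℤ` has integral `e`") that the vertex
elimination uses: it is single-valued and linear, and it integrates functions that are constant
outside a finite set as if points had mass one and `K` had mass `T`. The two instances are
summation over `Fin T`, and integration over `ℝ` with respect to an Euler characteristic, where
`T = 1`. -/
structure IsIntegral (H : (K → ℤ) → ℤ → Prop) (T : ℤ) : Prop where
  unique : ∀ {h e e'}, H h e → H h e' → e = e'
  add : ∀ {h e h' e'}, H h e → H h' e' → H (h + h') (e + e')
  const_mul : ∀ (c : ℤ) {h e}, H h e → H (fun y => c * h y) (c * e)
  of_const_off : ∀ (D : Finset K) (c : ℤ) (h : K → ℤ), (∀ y, y ∉ D → h y = c) →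
    H h (c * T + ∑ y ∈ D, (h y - c))

theorem IsIntegral.zero {H : (K → ℤ) → ℤ → Prop} {T : ℤ} (hH : IsIntegral H T) :
    H (fun _ => 0) 0 := by
  simpa using hH.of_const_off ∅ 0 (fun _ => 0) (fun _ _ => rfl)

variable [DecidableEq V]

/-- `G` is obtained from `F` by integrating out the coordinates in the list `l`, the first one
first. -/
def IteratedIntegral (H : (K → ℤ) → ℤ → Prop) :
    List V → ((V → K) → ℤ) → ((V → K) → ℤ) → Prop
  | [], F, G => F = G
  | v :: l, F, G => ∃ F' : (V → K) → ℤ, (∀ x, H (fun y => F (Function.update x v y)) (F' x)) ∧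
      IteratedIntegral H l F' G

namespace IteratedIntegral

variable {H : (K → ℤ) → ℤ → Prop} {T : ℤ}

theorem unique (hH : IsIntegral H T) {l : List V} {F G G' : (V → K) → ℤ}
    (h : IteratedIntegral H l F G) (h' : IteratedIntegral H l F G') : G = G' := by
  induction l generalizing F with
  | nil => exact h.symm.trans h'
  | cons v l ih =>
    obtain ⟨F₁, h1, h2⟩ := h
    obtain ⟨F₂, h1', h2'⟩ := h'
    obtain rfl : F₁ = F₂ := funext fun x => hH.unique (h1 x) (h1' x)
    exact ih h2 h2'

theorem zero (hH : IsIntegral H T) (l : List V) :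
    IteratedIntegral H l (fun _ : V → K => 0) (fun _ => 0) := by
  induction l with
  | nil => rfl
  | cons v l ih => exact ⟨fun _ => 0, fun _ => hH.zero, ih⟩

theorem add (hH : IsIntegral H T) {l : List V} {F G F' G' : (V → K) → ℤ}
    (h : IteratedIntegral H l F G) (h' : IteratedIntegral H l F' G') :
    IteratedIntegral H l (F + F') (G + G') := by
  induction l generalizing F F' with
  | nil => exact congrArg₂ _ h h'
  | cons v l ih =>
    obtain ⟨F₁, h1, h2⟩ := h
    obtain ⟨F₂, h1', h2'⟩ := h'
    exact ⟨F₁ + F₂, fun x => hH.add (h1 x) (h1' x), ih h2 h2'⟩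

theorem const_mul (hH : IsIntegral H T) (c : ℤ) {l : List V} {F G : (V → K) → ℤ}
    (h : IteratedIntegral H l F G) :
    IteratedIntegral H l (fun x => c * F x) (fun x => c * G x) := by
  induction l generalizing F with
  | nil =>
    obtain rfl : F = G := h
    rfl
  | cons v l ih =>
    obtain ⟨F₁, h1, h2⟩ := h
    exact ⟨fun x => c * F₁ x, fun x => hH.const_mul c (h1 x), ih h2⟩

theorem sum (hH : IsIntegral H T) {ι : Type*} (s : Finset ι) {l : List V}
    {F G : ι → (V → K) → ℤ} (h : ∀ i ∈ s, IteratedIntegral H l (F i) (G i)) :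
    IteratedIntegral H l (fun x => ∑ i ∈ s, F i x) (fun x => ∑ i ∈ s, G i x) := by
  classical
  induction s using Finset.induction_on with
  | empty => simpa using zero hH l
  | insert a s ha ih =>
    simp only [sum_insert ha]
    exact add hH (h a (mem_insert_self _ _)) (ih fun i hi => h i (mem_insert_of_mem hi))

end IteratedIntegral

end Integral

section Transfer

variable {K V : Type*} [DecidableEq V]

/-- The restriction of `x` to `S` is a proper colouring of `G.induce S`. -/
def Proper (G : SimpleGraph V) (S : Finset V) (x : V → K) : Prop :=
  ∀ u ∈ S, ∀ w ∈ S, G.Adj u w → x u ≠ x w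

theorem proper_insert_update {G : SimpleGraph V} {S N : Finset V} {v : V} (hv : v ∉ S)
    (hN : N ⊆ S) (hadj : ∀ u ∈ S, G.Adj v u ↔ u ∈ N) (x : V → K) (y : K) :
    Proper G (insert v S) (Function.update x v y) ↔ Proper G S x ∧ ∀ u ∈ N, x u ≠ y := by
  have hne : ∀ u ∈ S, u ≠ v := fun u hu h => hv (h ▸ hu)
  constructor
  · intro h
    refine ⟨fun u hu w hw huw => ?_, fun u hu => ?_⟩
    · have := h u (mem_insert_of_mem hu) w (mem_insert_of_mem hw) huw
      rwa [Function.update_of_ne (hne u hu), Function.update_of_ne (hne w hw)] at this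
    · have := h u (mem_insert_of_mem (hN hu)) v (mem_insert_self _ _)
        ((hadj u (hN hu)).2 hu).symm
      rwa [Function.update_of_ne (hne u (hN hu)), Function.update_self] at this
  · rintro ⟨h1, h2⟩ u hu w hw huw
    rcases mem_insert.1 hu with rfl | hu' <;> rcases mem_insert.1 hw with rfl | hw'
    · exact absurd huw (G.irrefl)
    · rw [Function.update_of_ne (hne w hw'), Function.update_self]
      exact (h2 w ((hadj w hw').1 huw)).symm
    · rw [Function.update_of_ne (hne u hu'), Function.update_self]
      exact h2 u ((hadj u hu').1 huw.symm)
    · rw [Function.update_of_ne (hne u hu'), Function.update_of_ne (hne w hw')]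
      exact h1 u hu' w hw' huw

variable [DecidableEq K] {H : (K → ℤ) → ℤ → Prop} {T : ℤ}

theorem image_update_of_notMem {O : Finset V} {v : V} (hv : v ∉ O) (x : V → K) (y : K) :
    O.image (Function.update x v y) = O.image x :=
  image_congr fun _ hu => Function.update_of_ne (ne_of_mem_of_not_mem hu hv) _ _

open Classical in
/-- Integrating out a vertex whose neighbours in `S` are the vertices of `O`. -/
theorem integral_proper_even (hH : IsIntegral H T) {G : SimpleGraph V} {S O : Finset V} {v : V}
    (hv : v ∉ S) (hO : O ⊆ S) (hadj : ∀ u ∈ S, G.Adj v u ↔ u ∈ O) (φ : ℕ → ℤ) (x : V → K) :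
    H (fun y => if Proper G (insert v S) (Function.update x v y) then
        φ #(O.image (Function.update x v y)) else 0)
      (if Proper G S x then (T - #(O.image x)) * φ #(O.image x) else 0) := by
  simp only [proper_insert_update hv hO hadj, image_update_of_notMem (fun h => hv (hO h))]
  by_cases hp : Proper G S x
  · simp only [hp, true_and, if_true]
    convert hH.of_const_off (O.image x) (φ #(O.image x)) _ _ using 1
    · rw [sum_congr rfl (g := fun _ => - φ #(O.image x))]
      · rw [sum_const, nsmul_eq_mul]; ring
      · intro y hy
        obtain ⟨u, hu, rfl⟩ := mem_image.1 hy
        rw [if_neg (fun h => h u hu rfl), zero_sub]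
    · intro y hy
      exact if_pos fun u hu h => hy (mem_image.2 ⟨u, hu, h⟩)
  · simpa only [hp, false_and, if_false] using hH.zero

open Classical in
/-- Integrating out a vertex that is to be added to `O` and whose neighbours `N` in `S` are
adjacent to all vertices of `O`. -/
theorem integral_proper_odd (hH : IsIntegral H T) {G : SimpleGraph V} {S O N : Finset V} {v : V}
    (hv : v ∉ S) (hO : O ⊆ S) (hN : N ⊆ S) (hadj : ∀ u ∈ S, G.Adj v u ↔ u ∈ N)
    (hNO : ∀ u ∈ N, ∀ w ∈ O, G.Adj u w) (hN1 : #N ≤ 1) (φ : ℕ → ℤ) (x : V → K) :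
    H (fun y => if Proper G (insert v S) (Function.update x v y) then
        φ #((insert v O).image (Function.update x v y)) else 0)
      (if Proper G S x then #(O.image x) * φ #(O.image x) +
        (T - #(O.image x) - #N) * φ (#(O.image x) + 1) else 0) := by
  simp only [proper_insert_update hv hN hadj, image_insert, Function.update_self,
    image_update_of_notMem (fun h => hv (hO h))]
  by_cases hp : Proper G S x
  · simp only [hp, true_and, if_true]
    have hdis : Disjoint (O.image x) (N.image x) := by
      rw [disjoint_left]
      intro y hy hy'
      obtain ⟨u, hu, rfl⟩ := mem_image.1 hy
      obtain ⟨w, hw, hwu⟩ := mem_image.1 hy'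
      exact hp w (hN hw) u (hO hu) (hNO w hw u hu) hwu
    have hcN : #(N.image x) = #N :=
      card_image_of_injOn fun a ha b hb _ => card_le_one.1 hN1 a ha b hb
    convert hH.of_const_off (O.image x ∪ N.image x) (φ (#(O.image x) + 1)) _ _ using 1
    · rw [sum_union hdis,
        sum_congr rfl (s₁ := O.image x) (g := fun _ => φ #(O.image x) - φ (#(O.image x) + 1)),
        sum_congr rfl (s₁ := N.image x) (g := fun _ => - φ (#(O.image x) + 1)), sum_const,
        sum_const, nsmul_eq_mul, nsmul_eq_mul, hcN]
      · ring
      · intro y hy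
        obtain ⟨u, hu, rfl⟩ := mem_image.1 hy
        rw [if_neg (fun h => h u hu rfl), zero_sub]
      · intro y hy
        rw [if_pos, insert_eq_self.2 hy]
        intro u hu h
        exact disjoint_left.1 hdis hy (mem_image.2 ⟨u, hu, h⟩)
    · intro y hy
      rw [mem_union, not_or] at hy
      rw [if_pos fun u hu h => hy.2 (mem_image.2 ⟨u, hu, h⟩), card_insert_of_notMem hy.1]
  · simpa only [hp, false_and, if_false] using hH.zero

end Transfer

section Gam

variable {K : Type*} {H : (K → ℤ) → ℤ → Prop} {T : ℤ}

/-- The vertices of `Γ_V` that remain when `3, 4, …, 2i+2` are the last vertices that have not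
been integrated out; those that are at least `b` are never integrated out. -/
def remaining (V : Finset ℕ) (b i : ℕ) : Finset V := {v | v.1 < 2 * i + 3 ∨ b ≤ v.1}

/-- The odd vertices less than `2i + 3`. -/
def oddsBelow (V : Finset ℕ) (i : ℕ) : Finset V := {v | v.1 < 2 * i + 3 ∧ Odd v.1}

open Classical in
/-- Integrating out the vertices `2i+2, 2i+1, …, 4, 3` of `Γ_V`, in this order. -/
theorem exists_iteratedIntegral_proper (hH : IsIntegral H T) {V : Finset ℕ} {b : ℕ}
    (hb : ∀ v : V, b ≤ v.1 → Even v.1) {N : Finset V} (hN : ∀ v, v ∈ N ↔ b ≤ v.1) (hN1 : #N ≤ 1)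
    (i : ℕ) (hi : 2 * i + 3 ≤ b) (hmem : ∀ j < i, 2 * j + 3 ∈ V ∧ 2 * j + 4 ∈ V) (φ : ℕ → ℤ) :
    ∃ l : List V, l.Nodup ∧ l.length = 2 * i ∧
      (∀ v, v ∈ l ↔ v ∈ remaining V b i ∧ v ∉ remaining V b 0) ∧
      IteratedIntegral H l
        (fun x => if Proper (Gam V) (remaining V b i) x then
          φ #((oddsBelow V i).image x) else 0)
        (fun x => if Proper (Gam V) (remaining V b 0) x then
          (roundOp T (#N : ℤ))^[i] φ #((oddsBelow V 0).image x) else 0) := by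
  induction i generalizing φ with
  | zero =>
    exact ⟨[], List.nodup_nil, rfl, by simp, rfl⟩
  | succ i ih =>
    obtain ⟨l, hl1, hl2, hl3, hl4⟩ := ih (by omega) (fun j hj => hmem j (by omega))
      (roundOp T (#N : ℤ) φ)
    let f : V := ⟨2 * i + 3, (hmem i (by omega)).1⟩
    let g : V := ⟨2 * i + 4, (hmem i (by omega)).2⟩
    have ef : f.1 = 2 * i + 3 := rfl
    have eg : g.1 = 2 * i + 4 := rfl
    have hS : remaining V b (i + 1) = insert g (insert f (remaining V b i)) := by
      ext v
      simp only [remaining, mem_filter, mem_univ, true_and, mem_insert, Subtype.ext_iff, ef, eg]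
      omega
    have hO : oddsBelow V (i + 1) = insert f (oddsBelow V i) := by
      ext v
      simp only [oddsBelow, mem_filter, mem_univ, true_and, mem_insert, Subtype.ext_iff, ef]
      grind
    have hfS : f ∉ remaining V b i := by
      simp only [remaining, mem_filter, mem_univ, true_and, ef]
      omega
    have hgS : g ∉ insert f (remaining V b i) := by
      simp only [remaining, mem_filter, mem_univ, true_and, mem_insert, Subtype.ext_iff, ef, eg]
      omega
    have hOS : oddsBelow V i ⊆ remaining V b i := by
      intro v
      simp only [oddsBelow, remaining, mem_filter, mem_univ, true_and]
      tauto
    have hNS : N ⊆ remaining V b i := by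
      intro v
      simp only [hN, remaining, mem_filter, mem_univ, true_and]
      tauto
    refine ⟨g :: f :: l, ?_, by simp [hl2]; ring, ?_, fun x =>
      if Proper (Gam V) (insert f (remaining V b i)) x then
        (T - #((insert f (oddsBelow V i)).image x)) * φ #((insert f (oddsBelow V i)).image x)
      else 0, fun x => ?_, _, fun x => ?_, hl4⟩
    · rw [List.nodup_cons, List.nodup_cons, List.mem_cons, not_or, hl3, hl3]
      refine ⟨⟨?_, fun h => hgS (mem_insert_of_mem h.1)⟩, fun h => hfS h.1, hl1⟩
      rw [Subtype.ext_iff, ef, eg]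
      omega
    · intro v
      have hf0 : f ∉ remaining V b 0 := by
        simp only [remaining, mem_filter, mem_univ, true_and, ef]
        omega
      have hg0 : g ∉ remaining V b 0 := by
        simp only [remaining, mem_filter, mem_univ, true_and, eg]
        omega
      rw [List.mem_cons, List.mem_cons, hl3, hS, mem_insert, mem_insert]
      constructor
      · rintro (rfl | rfl | h)
        · exact ⟨Or.inl rfl, hg0⟩
        · exact ⟨Or.inr (Or.inl rfl), hf0⟩
        · exact ⟨Or.inr (Or.inr h.1), h.2⟩
      · tauto
    · rw [hS, hO]
      refine integral_proper_even hH hgS (insert_subset_insert _ hOS) (fun u hu => ?_) φ x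
      have hbu := hb u
      simp only [remaining, mem_filter, mem_univ, true_and, mem_insert, Subtype.ext_iff, ef] at hu
      simp only [oddsBelow, mem_filter, mem_univ, true_and, mem_insert, Subtype.ext_iff, ef, Gam,
        eg]
      grind
    · convert integral_proper_odd hH hfS hOS hNS (fun u hu => ?_) (fun u hu w hw => ?_) hN1
        (fun k => (T - k) * φ k) x using 3
      · simp only [roundOp]
        push_cast
        ring
      · have hbu := hb u
        simp only [remaining, mem_filter, mem_univ, true_and] at hu
        simp only [hN, Gam, ef]
        grind
      · have hbu := hb u
        simp only [oddsBelow, mem_filter, mem_univ, true_and] at hw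
        rw [hN] at hu
        simp only [Gam]
        grind

end Gam

/-! ### Characteristic polynomials by Möbius inversion -/

theorem rk_eq_of_strictMono {P : Type*} [PartialOrder P] (f : P → ℕ) (hf : StrictMono f)
    (h : ∀ x, f x ≠ 0 → ∃ y < x, f y + 1 = f x) (x : P) : rk x = f x := by
  suffices H : ∀ n x, f x = n → Order.height x = n by
    rw [rk, H _ x rfl]
    rfl
  intro n
  induction n using Nat.strong_induction_on with
  | _ n ih =>
    rintro x rfl
    refine le_antisymm (Order.height_le_coe_iff.2 fun y hy => ?_) ?_
    · rw [ih _ (hf hy) y rfl]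
      exact_mod_cast hf hy
    · by_cases h0 : f x = 0
      · simp [h0]
      · obtain ⟨y, hy, hxy⟩ := h x h0
        rw [← hxy]
        have := Order.height_add_one_le hy
        rw [ih _ (hf hy) y rfl] at this
        exact_mod_cast this

/-- Möbius inversion: if the number of `c` with `x ≤ κ c` is the power of `t` that goes with `x` in
the characteristic polynomial, then the latter counts the `c` with `κ c = ⊥`. -/
theorem eval_charPoly_of_natCard {P C : Type*} [PartialOrder P] [Finite P] [OrderBot P] [Finite C]
    (κ : C → P) (t : ℤ) (h : ∀ x : P, (Nat.card {c // x ≤ κ c} : ℤ) = t ^ (length P - rk x)) :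
    (charPoly P).eval t = Nat.card {c // κ c = ⊥} := by
  classical
  let _ : Fintype P := Fintype.ofFinite P
  let _ : Fintype C := Fintype.ofFinite C
  let _ : LocallyFiniteOrder P := Fintype.toLocallyFiniteOrder
  have hμ : ∀ c : C, ∑ x with x ≤ κ c, moebius ⊥ x = if κ c = ⊥ then 1 else 0 := by
    intro c
    have h1 := IncidenceAlgebra.sum_Icc_mu_right (𝕜 := ℤ) (⊥ : P) (κ c)
    simp only [eq_comm (a := (⊥ : P))] at h1
    rw [← h1]
    refine sum_congr ?_ fun x _ => ?_
    · ext x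
      simp
    · unfold moebius
      congr!
  unfold charPoly
  rw [Polynomial.eval_finsetSum, Nat.card_eq_fintype_card, Fintype.card_subtype, card_filter]
  push_cast
  simp only [← hμ, sum_filter]
  rw [sum_comm]
  refine sum_congr (by congr!) fun x _ => ?_
  rw [Polynomial.eval_mul, Polynomial.eval_C, Polynomial.eval_pow, Polynomial.eval_X, ← h,
    ← sum_filter, sum_const, nsmul_eq_mul, Nat.card_eq_fintype_card, Fintype.card_subtype, mul_comm]

/-! ### Bond lattices and colourings -/

section Bond

variable {V : Type*} {G : SimpleGraph V}

/-- The number of blocks of a partition. -/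
def blocks (π : Setoid V) : ℕ := Nat.card (Quotient π)

theorem blocks_lt_blocks [Finite V] {π π' : Setoid V} (h : π < π') : blocks π' < blocks π := by
  let f : Quotient π → Quotient π' := Quotient.map' id fun a b hab => h.le hab
  have hf : Function.Surjective f := fun q => by
    induction q using Quotient.inductionOn with
    | h a => exact ⟨Quotient.mk _ a, rfl⟩
  refine lt_of_le_of_ne (Nat.card_le_card_of_surjective f hf) fun heq => h.not_ge ?_
  have hb := hf.bijective_of_nat_card_le heq.ge
  intro a b hab
  exact Quotient.exact (hb.1 (a₁ := Quotient.mk _ a) (a₂ := Quotient.mk _ b)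
    (Quotient.sound hab))

theorem blocks_le [Finite V] (π : Setoid V) : blocks π ≤ Nat.card V :=
  Nat.card_le_card_of_surjective _ Quotient.mk_surjective

/-- The partition obtained from `π` by making `{v}` a block. -/
def isolate (π : Setoid V) (v : V) : Setoid V where
  r a b := a = b ∨ (a ≠ v ∧ b ≠ v ∧ π a b)
  iseqv := by
    refine ⟨fun _ => Or.inl rfl, ?_, ?_⟩
    · rintro a b (rfl | ⟨h1, h2, h3⟩)
      · exact Or.inl rfl
      · exact Or.inr ⟨h2, h1, π.symm h3⟩
    · rintro a b c (rfl | ⟨h1, h2, h3⟩) (rfl | ⟨h1', h2', h3'⟩)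
      · exact Or.inl rfl
      · exact Or.inr ⟨h1', h2', h3'⟩
      · exact Or.inr ⟨h1, h2, h3⟩
      · exact Or.inr ⟨h1, h2', π.trans h3 h3'⟩

theorem isolate_iff {π : Setoid V} {v a b : V} :
    isolate π v a b ↔ a = b ∨ (a ≠ v ∧ b ≠ v ∧ π a b) := Iff.rfl

theorem isolate_le (π : Setoid V) (v : V) : isolate π v ≤ π := by
  rintro a b (rfl | h)
  · exact π.refl a
  · exact h.2.2

theorem blocks_isolate_le [Finite V] (π : Setoid V) (v : V) :
    blocks (isolate π v) ≤ blocks π + 1 := by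
  classical
  have h : blocks π + 1 = Nat.card (Option (Quotient π)) := Finite.card_option.symm
  rw [h]
  let f : Quotient (isolate π v) → Option (Quotient π) :=
    Quotient.lift (fun a => if a = v then none else some (Quotient.mk π a)) (by
      rintro a b (rfl | ⟨h1, h2, h3⟩)
      · rfl
      · simp only [h1, h2, if_false]
        exact congrArg some (Quotient.sound h3))
  refine Nat.card_le_card_of_injective f fun p q => ?_
  refine Quotient.inductionOn₂ p q fun a b hab => Quotient.sound ?_
  simp only [f, Quotient.lift_mk] at hab
  split_ifs at hab with h1 h2 h2
  · exact Or.inl (h1.trans h2.symm)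
  · exact Or.inr ⟨h1, h2, Quotient.exact (Option.some.inj hab)⟩

theorem connected_induce_singleton (G : SimpleGraph V) (v : V) : (G.induce {v}).Connected :=
  { preconnected := fun a b => by
      rw [Subtype.ext ((Set.mem_singleton_iff.1 a.2).trans (Set.mem_singleton_iff.1 b.2).symm)]
    nonempty := ⟨⟨v, rfl⟩⟩ }

/-- A bond other than `⊥` covers the bond obtained by splitting off, from a block with at least
two elements, a vertex whose removal leaves the block connected. -/
theorem exists_bond_lt [Finite V] (π : BondLattice G) (h : π ≠ ⊥) :
    ∃ π' < π, blocks π'.1 = blocks π.1 + 1 := by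
  obtain ⟨a, b, hab, hne⟩ : ∃ a b, π.1 a b ∧ a ≠ b := by
    by_contra! hcon
    exact h (le_bot_iff.1 fun a b hab => hcon a b hab)
  have hconn := π.2 {x | π.1 x a} ⟨a, rfl⟩
  have : Nontrivial ({x | π.1 x a} : Set V) :=
    ⟨⟨a, π.1.refl a⟩, ⟨b, π.1.symm hab⟩, fun h => hne (congrArg Subtype.val h)⟩
  obtain ⟨⟨v, hv⟩, hvc⟩ := hconn.exists_connected_induce_compl_singleton_of_finite_nontrivial
  have hv' : π.1 v a := hv
  have hbond : ∀ B ∈ (isolate π.1 v).classes, (G.induce B).Connected := by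
    rintro B ⟨y, rfl⟩
    by_cases hy : y = v
    · have : {x | isolate π.1 v x y} = {v} := by
        ext x
        simp only [Set.mem_ofPred_eq, isolate_iff, Set.mem_singleton_iff, hy]
        tauto
      rw [this]
      exact connected_induce_singleton G v
    by_cases hyv : π.1 y v
    · let f : (G.induce {x | π.1 x a}).induce {⟨v, hv⟩}ᶜ →g
          G.induce {x | isolate π.1 v x y} :=
        { toFun := fun z => ⟨z.1.1, Or.inr ⟨fun hz => z.2 (Subtype.ext hz), hy,
            π.1.trans z.1.2 (π.1.trans (π.1.symm hv') (π.1.symm hyv))⟩⟩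
          map_rel' := fun hadj => hadj }
      refine hvc.map f fun z => ?_
      have hz : z.1 ≠ v ∧ π.1 z.1 y := by
        rcases z.2 with h1 | h1
        · rw [h1]; exact ⟨hy, π.1.refl y⟩
        · exact ⟨h1.1, h1.2.2⟩
      exact ⟨⟨⟨z.1, π.1.trans hz.2 (π.1.trans hyv hv')⟩,
        fun h => hz.1 (congrArg Subtype.val h)⟩, rfl⟩
    · have : {x | isolate π.1 v x y} = {x | π.1 x y} := by
        ext x
        simp only [Set.mem_ofPred_eq, isolate_iff]
        constructor
        · rintro (rfl | h)
          · exact π.1.refl x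
          · exact h.2.2
        · intro hxy
          refine Or.inr ⟨?_, hy, hxy⟩
          rintro rfl
          exact hyv (π.1.symm hxy)
      rw [this]
      exact π.2 _ ⟨y, rfl⟩
  have hlt : isolate π.1 v < π.1 := by
    refine lt_of_le_not_ge (isolate_le _ _) fun hle => ?_
    obtain ⟨w, hw, hwv⟩ : ∃ w, π.1 w a ∧ w ≠ v := by
      by_cases hav : a = v
      · exact ⟨b, π.1.symm hab, fun h => hne (hav.trans h.symm)⟩
      · exact ⟨a, π.1.refl a, hav⟩
    rcases hle (π.1.trans hw (π.1.symm hv')) with h1 | h1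
    · exact hwv h1
    · exact h1.2.1 rfl
  exact ⟨⟨isolate π.1 v, hbond⟩, hlt,
    le_antisymm (blocks_isolate_le _ _) (blocks_lt_blocks hlt)⟩

/-- The subgraph of the monochromatic edges of a colouring. -/
def monoGraph (G : SimpleGraph V) {K : Type*} (c : V → K) : SimpleGraph V where
  Adj i j := G.Adj i j ∧ c i = c j
  symm := ⟨fun _ _ h => ⟨h.1.symm, h.2.symm⟩⟩
  loopless := ⟨fun _ h => G.irrefl h.1⟩

/-- The partition into the connected components of the subgraph of monochromatic edges. -/
def monoBond (G : SimpleGraph V) {K : Type*} (c : V → K) : BondLattice G :=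
  ⟨(monoGraph G c).reachableSetoid, by
    rintro B ⟨y, rfl⟩
    have h : ((monoGraph G c).induce ((monoGraph G c).connectedComponentMk y).supp).Connected :=
      ((monoGraph G c).connectedComponentMk y).connected_toSimpleGraph
    have e : ((monoGraph G c).connectedComponentMk y).supp =
        {x | (monoGraph G c).reachableSetoid x y} := by
      ext x
      rw [SimpleGraph.ConnectedComponent.mem_supp_iff, SimpleGraph.ConnectedComponent.eq]
      rfl
    rw [e] at h
    exact h.mono fun a b hadj => (show (monoGraph G c).Adj a.1 b.1 from hadj).1⟩

theorem monoBond_apply {K : Type*} {c : V → K} {a b : V} :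
    (monoBond G c).1 a b ↔ (monoGraph G c).Reachable a b := Iff.rfl

theorem eq_of_monoBond {K : Type*} {c : V → K} {a b : V} (h : (monoBond G c).1 a b) :
    c a = c b := by
  obtain ⟨w⟩ := monoBond_apply.1 h
  induction w with
  | nil => rfl
  | cons hadj _ ih => exact hadj.2.trans (ih ⟨‹_›⟩)

/-- A colouring is constant on the blocks of a bond exactly when the bond refines the partition
into monochromatic components. -/
theorem le_monoBond_iff {K : Type*} {c : V → K} {π : BondLattice G} :
    π ≤ monoBond G c ↔ ∀ a b, π.1 a b → c a = c b := by
  constructor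
  · exact fun h a b hab => eq_of_monoBond (h hab)
  · intro h a b hab
    let f : G.induce {x | π.1 x b} →g monoGraph G c :=
      { toFun := Subtype.val
        map_rel' := fun {x y} hadj => ⟨hadj, h _ _ (π.1.trans x.2 (π.1.symm y.2))⟩ }
    exact ((π.2 _ ⟨b, rfl⟩).preconnected ⟨a, hab⟩ ⟨b, π.1.refl b⟩).map f

theorem monoBond_eq_bot_iff {K : Type*} {c : V → K} :
    monoBond G c = ⊥ ↔ ∀ a b, G.Adj a b → c a ≠ c b := by
  constructor
  · intro h a b hab hc
    have h1 : (monoBond G c).1 a b := SimpleGraph.Adj.reachable ⟨hab, hc⟩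
    rw [h] at h1
    exact hab.ne h1
  · intro h
    have hbot : monoGraph G c = ⊥ := by
      ext a b
      simp only [SimpleGraph.bot_adj, iff_false]
      exact fun hab => h a b hab.1 hab.2
    refine le_bot_iff.1 fun a b hab => ?_
    rw [monoBond_apply, hbot, SimpleGraph.reachable_bot] at hab
    exact hab

theorem card_le_blocks [Finite V] (π : Setoid V) (S : Finset V)
    (h : ∀ u ∈ S, ∀ v ∈ S, π u v → u = v) : #S ≤ blocks π := by
  have hS : #S = Nat.card S := by simp
  rw [hS]
  refine Nat.card_le_card_of_injective (fun u : S => Quotient.mk π u.1) fun u v huv => ?_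
  exact Subtype.ext (h u u.2 v v.2 (Quotient.exact huv))

/-- The colourings that are constant on the blocks of `π` and have prescribed colours on a set `S`
that meets each block at most once. -/
theorem natCard_const_on_blocks [Finite V] (π : Setoid V) (S : Finset V)
    (h : ∀ u ∈ S, ∀ v ∈ S, π u v → u = v) (t : ℕ) (x₀ : V → Fin t) :
    Nat.card {c : V → Fin t // (∀ v ∈ S, c v = x₀ v) ∧ ∀ a b, π a b → c a = c b} =
      t ^ (blocks π - #S) := by
  classical
  let _ : Fintype V := Fintype.ofFinite V
  let Q := S.image (Quotient.mk π)
  have hQ : #Q = #S := card_image_of_injOn fun u hu v hv huv => h u hu v hv (Quotient.exact huv)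
  let A : Quotient π → Finset (Fin t) := fun q => {y | ∀ v ∈ S, Quotient.mk π v = q → x₀ v = y}
  have hA : ∀ q, #(A q) = if q ∈ Q then 1 else t := by
    intro q
    split_ifs with hq
    · obtain ⟨v, hv, rfl⟩ := mem_image.1 hq
      rw [card_eq_one]
      refine ⟨x₀ v, ?_⟩
      ext y
      simp only [A, mem_filter, mem_univ, true_and, mem_singleton]
      constructor
      · exact fun hy => (hy v hv rfl).symm
      · rintro rfl w hw hwv
        rw [h w hw v hv (Quotient.exact hwv)]
    · have : A q = univ := filter_true_of_mem fun y _ v hv hvq =>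
        absurd (mem_image.2 ⟨v, hv, hvq⟩) hq
      rw [this, card_univ, Fintype.card_fin]
  have hcard : #(Fintype.piFinset A) = t ^ (blocks π - #S) := by
    rw [Fintype.card_piFinset, prod_congr rfl fun q _ => hA q, prod_ite, prod_const_one, one_mul,
      prod_const, ← hQ, blocks, Nat.card_eq_fintype_card, ← card_univ, ← card_sdiff_of_subset
      (subset_univ _)]
    congr 2
    ext q
    simp
  rw [← hcard, Nat.card_eq_fintype_card, Fintype.card_subtype]
  symm
  refine card_bij (fun g _ v => g (Quotient.mk π v)) ?_ ?_ ?_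
  · intro g hg
    simp only [mem_filter, mem_univ, true_and, Fintype.mem_piFinset, A] at hg ⊢
    exact ⟨fun v hv => (hg _ v hv rfl).symm, fun a b hab => congrArg g (Quotient.sound hab)⟩
  · intro g _ g' _ hgg
    funext q
    induction q using Quotient.inductionOn with
    | h a => exact congrFun hgg a
  · intro c hc
    simp only [mem_filter, mem_univ, true_and] at hc
    refine ⟨Quotient.lift c fun a b hab => hc.2 a b hab, ?_, rfl⟩
    simp only [Fintype.mem_piFinset, A, mem_filter, mem_univ, true_and]
    rintro q v hv rfl
    exact (hc.1 v hv).symm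

/-- Let `P` be the poset of the bonds of `G` that separate the elements of `S`. If some such bond
has only `#S` blocks, then the characteristic polynomial of `P` counts the proper colourings with
given distinct colours on `S`. -/
theorem eval_charPoly_of_separating [Finite V] {P : Type*} [PartialOrder P] [Finite P] [OrderBot P]
    (e : P ↪o BondLattice G) (S : Finset V)
    (he : ∀ π : BondLattice G, (∃ p, e p = π) ↔ ∀ u ∈ S, ∀ v ∈ S, π.1 u v → u = v)
    (hmin : ∃ p, blocks (e p).1 = #S) (t : ℕ) (x₀ : V → Fin t)
    (hx₀ : ∀ u ∈ S, ∀ v ∈ S, x₀ u = x₀ v → u = v) :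
    (charPoly P).eval (t : ℤ) =
      Nat.card {c : V → Fin t // (∀ v ∈ S, c v = x₀ v) ∧ ∀ a b, G.Adj a b → c a ≠ c b} := by
  classical
  have hsep : ∀ p, ∀ u ∈ S, ∀ v ∈ S, (e p).1 u v → u = v := fun p => (he _).1 ⟨p, rfl⟩
  have hrk : ∀ p : P, rk p = Nat.card V - blocks (e p).1 := by
    refine fun p => rk_eq_of_strictMono (fun p => Nat.card V - blocks (e p).1) ?_ ?_ p
    · intro p q hpq
      have h1 := blocks_lt_blocks (π := (e p).1) (π' := (e q).1) (e.strictMono hpq)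
      have h2 := blocks_le (e p).1
      dsimp only
      omega
    · intro p hp
      have hne : e p ≠ ⊥ := by
        intro h0
        rw [h0] at hp
        refine hp ?_
        have : blocks (⊥ : BondLattice G).1 = Nat.card V := by
          refine le_antisymm (blocks_le _) (Nat.card_le_card_of_injective (Quotient.mk _) ?_)
          exact fun a b hab => Quotient.exact hab
        rw [this, Nat.sub_self]
      obtain ⟨π', hlt, hb⟩ := exists_bond_lt (e p) hne
      obtain ⟨q, rfl⟩ := (he π').2 fun u hu v hv huv => hsep p u hu v hv (hlt.le huv)
      have h2 := blocks_le (e q).1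
      exact ⟨q, e.lt_iff_lt.1 hlt, by omega⟩
  have hlen : length P = Nat.card V - #S := by
    unfold length
    refine le_antisymm (Finset.sup_le fun p _ => ?_) ?_
    · rw [hrk]
      have := card_le_blocks (e p).1 S (hsep p)
      omega
    · obtain ⟨p, hp⟩ := hmin
      rw [← hp, ← hrk p]
      exact Finset.le_sup (f := fun p : P => rk p) (@Finset.mem_univ P (Fintype.ofFinite P) p)
  have hC : ∀ c : {c : V → Fin t // ∀ v ∈ S, c v = x₀ v}, ∃ p, e p = monoBond G c.1 := by
    intro c
    refine (he _).2 fun u hu v hv huv => hx₀ u hu v hv ?_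
    rw [← c.2 u hu, ← c.2 v hv]
    exact eq_of_monoBond huv
  choose κ hκ using hC
  have hbot : e ⊥ = ⊥ := by
    obtain ⟨p, hp⟩ := (he ⊥).2 fun u _ v _ huv => huv
    exact le_bot_iff.1 (hp ▸ e.monotone bot_le)
  rw [eval_charPoly_of_natCard κ]
  · norm_cast
    refine Nat.card_congr ((Equiv.subtypeSubtypeEquivSubtypeInter _ _).symm.trans
      (Equiv.subtypeEquivRight fun c => ?_)).symm
    rw [← e.injective.eq_iff, hκ, hbot, monoBond_eq_bot_iff]
  · intro p
    have hp1 := card_le_blocks (e p).1 S (hsep p)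
    have hp2 := blocks_le (e p).1
    have hexp : length P - rk p = blocks (e p).1 - #S := by
      rw [hlen, hrk]
      omega
    rw [hexp]
    norm_cast
    rw [← natCard_const_on_blocks (e p).1 S (hsep p) t x₀]
    refine Nat.card_congr ((Equiv.subtypeEquivRight fun c => ?_).trans
      (Equiv.subtypeSubtypeEquivSubtypeInter _ _))
    rw [← e.le_iff_le, hκ, le_monoBond_iff]

end Bond

/-! ### The two characteristic polynomials -/

theorem IteratedIntegral.append {K V : Type*} [DecidableEq V] {H : (K → ℤ) → ℤ → Prop}
    {l l' : List V} {F F' F'' : (V → K) → ℤ} (h : IteratedIntegral H l F F')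
    (h' : IteratedIntegral H l' F' F'') : IteratedIntegral H (l ++ l') F F'' := by
  induction l generalizing F with
  | nil =>
    obtain rfl : F = F' := h
    exact h'
  | cons v l ih =>
    obtain ⟨F₁, h1, h2⟩ := h
    exact ⟨F₁, h1, ih h2⟩

/-- Summation, as an integral. -/
def SumIntegral (K : Type*) [Fintype K] (h : K → ℤ) (e : ℤ) : Prop := e = ∑ y, h y

theorem isIntegral_sumIntegral (K : Type*) [Fintype K] [DecidableEq K] :
    IsIntegral (SumIntegral K) (Fintype.card K : ℤ) where
  unique h h' := h.trans h'.symm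
  add h h' := by
    rw [SumIntegral] at *
    simp [h, h', sum_add_distrib]
  const_mul c _ _ h := by
    rw [SumIntegral] at *
    rw [h, mul_sum]
  of_const_off D c h hc := by
    rw [SumIntegral, sum_subset (subset_univ D) fun y _ hy => by rw [hc y hy, sub_self],
      sum_sub_distrib, sum_const, card_univ, nsmul_eq_mul]
    ring

theorem IteratedIntegral.eq_sum {K V : Type*} [Fintype K] [DecidableEq K] [Fintype V]
    [DecidableEq V] {l : List V} (hl : l.Nodup) {F G : (V → K) → ℤ}
    (h : IteratedIntegral (SumIntegral K) l F G) (x : V → K) :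
    G x = ∑ c with ∀ v ∉ l, c v = x v, F c := by
  induction l generalizing F with
  | nil =>
    obtain rfl : F = G := h
    have : ({c | ∀ v ∉ ([] : List V), c v = x v} : Finset (V → K)) = {x} := by
      ext c
      simp [funext_iff]
    rw [this, sum_singleton]
  | cons v l ih =>
    obtain ⟨F₁, h1, h2⟩ := h
    rw [List.nodup_cons] at hl
    have h3 : ∀ x, F₁ x = ∑ y, F (Function.update x v y) := h1
    rw [ih hl.2 h2]
    simp only [h3]
    rw [← sum_product']
    refine sum_bij' (fun p _ => Function.update p.1 v p.2)
      (fun c _ => (Function.update c v (x v), c v)) ?_ ?_ ?_ ?_ ?_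
    · rintro ⟨c, y⟩ hc
      simp only [mem_product, mem_filter, mem_univ, true_and, and_true] at hc ⊢
      intro u hu
      rw [List.mem_cons, not_or] at hu
      rw [Function.update_of_ne hu.1]
      exact hc u hu.2
    · intro c hc
      simp only [mem_product, mem_filter, mem_univ, true_and, and_true] at hc ⊢
      intro u hu
      by_cases huv : u = v
      · rw [huv, Function.update_self]
      · rw [Function.update_of_ne huv]
        exact hc u (by rw [List.mem_cons, not_or]; exact ⟨huv, hu⟩)
    · rintro ⟨c, y⟩ hc
      simp only [mem_product, mem_filter, mem_univ, true_and, and_true] at hc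
      simp [← hc v hl.1]
    · intro c _
      simp
    · intro _ _
      rfl

open Classical in
theorem natCard_proper_of_iteratedIntegral {V : Type*} [Fintype V] [DecidableEq V]
    (G : SimpleGraph V) (S : Finset V) (t : ℕ) (x₀ : V → Fin t) {l : List V} (hl : l.Nodup)
    (hS : ∀ v, v ∈ l ↔ v ∉ S) {F : (V → Fin t) → ℤ}
    (h : IteratedIntegral (SumIntegral (Fin t)) l
      (fun x => if Proper G univ x then 1 else 0) F) :
    (Nat.card {c : V → Fin t // (∀ v ∈ S, c v = x₀ v) ∧ ∀ a b, G.Adj a b → c a ≠ c b} : ℤ) =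
      F x₀ := by
  rw [h.eq_sum hl, ← sum_filter, sum_const, nsmul_eq_mul, mul_one, filter_filter,
    Nat.card_eq_fintype_card, Fintype.card_subtype]
  congr 2
  ext c
  simp [hS, Proper]

theorem connected_induce_of_star {V : Type*} {G : SimpleGraph V} {B : Set V} (a : V) (ha : a ∈ B)
    (h : ∀ b ∈ B, b ≠ a → G.Adj a b) : (G.induce B).Connected := by
  rw [SimpleGraph.connected_iff_exists_forall_reachable]
  refine ⟨⟨a, ha⟩, fun b => ?_⟩
  by_cases hb : b.1 = a
  · rw [show b = ⟨a, ha⟩ from Subtype.ext hb]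
  · exact SimpleGraph.Adj.reachable (show G.Adj a b.1 from h b.1 b.2 hb)

section Reduced

variable {n : ℕ} (hn : 2 ≤ n)

theorem mem_redVerts {v : ℕ} :
    v ∈ redVerts n ↔ 1 ≤ v ∧ v ≤ 2 * n ∧ v ≠ 2 ∧ v ≠ 2 * n - 1 := by
  simp only [redVerts, mem_sdiff, mem_Icc, mem_insert, mem_singleton]
  tauto

theorem eq_vFirst_iff {v : redVerts n} : v = vFirst n hn ↔ v.1 = 1 := Subtype.ext_iff

theorem eq_vLast_iff {v : redVerts n} : v = vLast n hn ↔ v.1 = 2 * n := Subtype.ext_iff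

theorem vFirst_ne_vLast : vFirst n hn ≠ vLast n hn := by
  rw [Ne, eq_vLast_iff]
  change ¬ 1 = 2 * n
  omega

theorem gam_adj_vFirst {v : redVerts n} (hv : Even v.1) : (Gam (redVerts n)).Adj (vFirst n hn) v := by
  have h := mem_redVerts.1 v.2
  refine Or.inl ⟨?_, odd_one, hv⟩
  change 1 < v.1
  grind

theorem gam_adj_vLast {v : redVerts n} (hv : Odd v.1) : (Gam (redVerts n)).Adj (vLast n hn) v := by
  have h := mem_redVerts.1 v.2
  refine Or.inr ⟨?_, hv, even_two_mul n⟩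
  change v.1 < 2 * n
  grind

open Classical in
/-- Integrating out all vertices of the reduced graph but `1` and `2n`. -/
theorem exists_iteratedIntegral_redVerts {K : Type*} {H : (K → ℤ) → ℤ → Prop} {T : ℤ}
    (hH : IsIntegral H T) :
    ∃ l : List (redVerts n), l.Nodup ∧ l.length = 2 * (n - 2) ∧
      (∀ v, v ∈ l ↔ v ∉ ({vFirst n hn, vLast n hn} : Finset (redVerts n))) ∧
      IteratedIntegral H l (fun x => if Proper (Gam (redVerts n)) univ x then 1 else 0)
        (fun x => if x (vFirst n hn) = x (vLast n hn) then 0 else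
          (roundOp T 1)^[n - 2] (fun _ => 1) 1) := by
  obtain ⟨l, h1, h2, h3, h4⟩ := exists_iteratedIntegral_proper hH (V := redVerts n) (b := 2 * n)
    (N := {vLast n hn}) (by
      intro v hv
      have := mem_redVerts.1 v.2
      exact ⟨n, by omega⟩)
    (by
      intro v
      have := mem_redVerts.1 v.2
      rw [mem_singleton, eq_vLast_iff]
      omega)
    (card_singleton _).le (n - 2) (by omega) (by
      intro j hj
      rw [mem_redVerts, mem_redVerts]
      omega) (fun _ => 1)
  -- Nothing is missing at the top, because `2n - 1` is not a vertex.
  have e1 : remaining (redVerts n) (2 * n) (n - 2) = univ := by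
    refine filter_true_of_mem fun v _ => ?_
    have := mem_redVerts.1 v.2
    omega
  have e2 : remaining (redVerts n) (2 * n) 0 = {vFirst n hn, vLast n hn} := by
    ext v
    have := mem_redVerts.1 v.2
    simp only [remaining, mem_filter, mem_univ, true_and, mem_insert, mem_singleton,
      eq_vFirst_iff, eq_vLast_iff]
    omega
  have e3 : oddsBelow (redVerts n) 0 = {vFirst n hn} := by
    ext v
    have := mem_redVerts.1 v.2
    simp only [oddsBelow, mem_filter, mem_univ, true_and, mem_singleton, eq_vFirst_iff]
    constructor
    · rintro ⟨_, _⟩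
      omega
    · intro h
      rw [h]
      exact ⟨by omega, odd_one⟩
  rw [e1, e2, e3, card_singleton, Nat.cast_one] at h4
  rw [e2] at h3
  refine ⟨l, h1, h2, fun v => by rw [h3, e1]; simp, ?_⟩
  convert h4 using 2 with x
  have hadj : (Gam (redVerts n)).Adj (vFirst n hn) (vLast n hn) :=
    gam_adj_vFirst hn (even_two_mul n)
  have hp : Proper (Gam (redVerts n)) {vFirst n hn, vLast n hn} x ↔
      x (vFirst n hn) ≠ x (vLast n hn) := by
    constructor
    · exact fun h => h _ (by simp) _ (by simp) hadj
    · intro h u hu w hw huw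
      rw [mem_insert, mem_singleton] at hu hw
      rcases hu with rfl | rfl <;> rcases hw with rfl | rfl
      · exact absurd huw ((Gam _).irrefl)
      · exact h
      · exact h.symm
      · exact absurd huw ((Gam _).irrefl)
  by_cases hx : x (vFirst n hn) = x (vLast n hn)
  · rw [if_pos hx, if_neg (fun h => hp.1 h hx)]
  · rw [if_neg hx, if_pos (hp.2 hx), image_singleton, card_singleton]

/-- The blocks of this maximal element are the stars `{1} ∪ {4, 6, …, 2n-2}` and
`{2n} ∪ {3, 5, …, 2n-3}`. -/
theorem exists_blocks_eq_two : ∃ p : L n hn, blocks p.1.1 = 2 := by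
  let f : redVerts n → Prop := fun v => v.1 = 1 ∨ (Even v.1 ∧ v.1 ≠ 2 * n)
  have hf1 : f (vFirst n hn) := Or.inl rfl
  have hfn : ¬ f (vLast n hn) := by
    rintro (h | h)
    · change 2 * n = 1 at h
      omega
    · exact h.2 rfl
  have hbond : ∀ B ∈ (Setoid.ker f).classes, ((Gam (redVerts n)).induce B).Connected := by
    rintro B ⟨y, rfl⟩
    by_cases hy : f y
    · refine connected_induce_of_star (vFirst n hn) ?_ fun v hv hne => ?_
      · change f _ = f y
        simp only [hf1, hy]
      · have hv : f v = f y := hv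
        have hv' : f v := hv ▸ hy
        rw [Ne, eq_vFirst_iff] at hne
        exact gam_adj_vFirst hn (hv'.resolve_left hne).1
    · refine connected_induce_of_star (vLast n hn) ?_ fun v hv hne => ?_
      · change f _ = f y
        simp only [hfn, hy]
      · have hv : f v = f y := hv
        have hv' : ¬ f v := hv ▸ hy
        rw [Ne, eq_vLast_iff] at hne
        refine gam_adj_vLast hn (Nat.not_even_iff_odd.1 fun he => hv' (Or.inr ⟨he, hne⟩))
  refine ⟨⟨⟨Setoid.ker f, hbond⟩, fun h => ?_⟩, ?_⟩
  · have h : f (vFirst n hn) = f (vLast n hn) := h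
    exact hfn (h ▸ hf1)
  · have hsurj : Function.Surjective f := by
      intro p
      by_cases hp : p
      · exact ⟨vFirst n hn, by simp only [hf1, hp]⟩
      · exact ⟨vLast n hn, by simp only [hfn, hp]⟩
    change Nat.card (Quotient (Setoid.ker f)) = 2
    rw [Nat.card_congr (Setoid.quotientKerEquivOfSurjective f hsurj)]
    simp

theorem eval_charPoly_L (t : ℕ) (ht : 2 ≤ t) :
    (charPoly (L n hn)).eval (t : ℤ) = (roundOp (t : ℤ) 1)^[n - 2] (fun _ => 1) 1 := by
  classical
  let x₀ : redVerts n → Fin t := fun v => if v.1 = 1 then ⟨0, by omega⟩ else ⟨1, by omega⟩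
  have hx1 : x₀ (vFirst n hn) = ⟨0, by omega⟩ := if_pos rfl
  have hxn : x₀ (vLast n hn) = ⟨1, by omega⟩ := if_neg (by change ¬ 2 * n = 1; omega)
  have hx : x₀ (vFirst n hn) ≠ x₀ (vLast n hn) := by
    rw [hx1, hxn]
    simp
  have hsep : ∀ R : redVerts n → redVerts n → Prop, (∀ a b, R a b → R b a) →
      ((∀ u ∈ ({vFirst n hn, vLast n hn} : Finset (redVerts n)),
        ∀ v ∈ ({vFirst n hn, vLast n hn} : Finset (redVerts n)), R u v → u = v) ↔
      ¬ R (vFirst n hn) (vLast n hn)) := by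
    intro R hR
    constructor
    · exact fun h h' => vFirst_ne_vLast hn (h _ (by simp) _ (by simp) h')
    · intro h u hu v hv huv
      rw [mem_insert, mem_singleton] at hu hv
      rcases hu with rfl | rfl <;> rcases hv with rfl | rfl
      · rfl
      · exact absurd huv h
      · exact absurd (hR _ _ huv) h
      · rfl
  rw [eval_charPoly_of_separating (G := Gam (redVerts n)) (OrderEmbedding.subtype _)
    {vFirst n hn, vLast n hn} ?_ ?_ t x₀ ?_]
  · obtain ⟨l, h1, -, h3, h4⟩ :=
      exists_iteratedIntegral_redVerts hn (isIntegral_sumIntegral (Fin t))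
    rw [natCard_proper_of_iteratedIntegral _ _ t x₀ h1 h3 h4, if_neg hx, Fintype.card_fin]
  · intro π
    rw [hsep π.1 fun a b => π.1.symm]
    constructor
    · rintro ⟨p, rfl⟩
      exact p.2
    · exact fun h => ⟨⟨π, h⟩, rfl⟩
  · obtain ⟨p, hp⟩ := exists_blocks_eq_two hn
    exact ⟨p, hp.trans (card_pair (vFirst_ne_vLast hn)).symm⟩
  · exact (hsep (fun u v => x₀ u = x₀ v) fun _ _ h => h.symm).2 hx

end Reduced

theorem eval_charPoly_bondLattice {n : ℕ} (hn : 1 ≤ n) (t : ℕ) (ht : 1 ≤ t) :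
    (charPoly (BondLattice (Gam (Icc 1 (2 * n))))).eval (t : ℤ) =
      (t - 1) * (roundOp (t : ℤ) 0)^[n - 1] (fun _ => 1) 1 := by
  classical
  let G := Gam (Icc 1 (2 * n))
  let v₁ : Icc 1 (2 * n) := ⟨1, by rw [mem_Icc]; omega⟩
  let v₂ : Icc 1 (2 * n) := ⟨2, by rw [mem_Icc]; omega⟩
  let vₙ : Icc 1 (2 * n) := ⟨2 * n, by rw [mem_Icc]; omega⟩
  have eq1 : ∀ v, v = v₁ ↔ v.1 = 1 := fun v => Subtype.ext_iff
  have eq2 : ∀ v, v = v₂ ↔ v.1 = 2 := fun v => Subtype.ext_iff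
  have hadj1 : ∀ v : Icc 1 (2 * n), Even v.1 → G.Adj v₁ v := by
    intro v hv
    have h := mem_Icc.1 v.2
    refine Or.inl ⟨?_, odd_one, hv⟩
    change 1 < v.1
    grind
  have hadjn : ∀ v : Icc 1 (2 * n), Odd v.1 → G.Adj vₙ v := by
    intro v hv
    have h := mem_Icc.1 v.2
    refine Or.inr ⟨?_, hv, even_two_mul n⟩
    change v.1 < 2 * n
    grind
  have hreach : ∀ v, G.Reachable v₁ v := by
    intro v
    rcases Nat.even_or_odd v.1 with h | h
    · exact (hadj1 v h).reachable
    · exact (hadj1 vₙ (even_two_mul n)).reachable.trans (hadjn v h).reachable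
  have hconn : ∀ B ∈ (⊤ : Setoid (Icc 1 (2 * n))).classes, (G.induce B).Connected := by
    rintro B ⟨y, rfl⟩
    have : {x | (⊤ : Setoid (Icc 1 (2 * n))) x y} = Set.univ := Set.eq_univ_of_forall fun _ => trivial
    rw [this, (SimpleGraph.induceUnivIso G).connected_iff,
      SimpleGraph.connected_iff_exists_forall_reachable]
    exact ⟨v₁, hreach⟩
  let x₀ : Icc 1 (2 * n) → Fin t := fun _ => ⟨0, by omega⟩
  have hsep : ∀ R : Icc 1 (2 * n) → Icc 1 (2 * n) → Prop,
      ∀ u ∈ ({v₁} : Finset (Icc 1 (2 * n))), ∀ v ∈ ({v₁} : Finset (Icc 1 (2 * n))),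
        R u v → u = v := by
    intro R u hu v hv _
    rw [mem_singleton.1 hu, mem_singleton.1 hv]
  rw [eval_charPoly_of_separating (G := G) (RelEmbedding.refl _) {v₁} ?_ ?_ t x₀ (hsep _)]
  · obtain ⟨l, h1, -, h3, h4⟩ := exists_iteratedIntegral_proper
      (isIntegral_sumIntegral (Fin t)) (V := Icc 1 (2 * n)) (b := 2 * n + 1) (N := ∅) (by
        intro v hv
        have := mem_Icc.1 v.2
        omega)
      (by
        intro v
        have := mem_Icc.1 v.2
        simp only [notMem_empty, false_iff]
        omega)
      (by simp) (n - 1) (by omega) (by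
        intro j hj
        rw [mem_Icc, mem_Icc]
        omega) (fun _ => 1)
    have e1 : remaining (Icc 1 (2 * n)) (2 * n + 1) (n - 1) = univ := by
      refine filter_true_of_mem fun v _ => ?_
      have := mem_Icc.1 v.2
      omega
    have e2 : remaining (Icc 1 (2 * n)) (2 * n + 1) 0 = {v₂, v₁} := by
      ext v
      have := mem_Icc.1 v.2
      simp only [remaining, mem_filter, mem_univ, true_and, mem_insert, mem_singleton, eq1, eq2]
      omega
    have e3 : oddsBelow (Icc 1 (2 * n)) 0 = {v₁} := by
      ext v
      have := mem_Icc.1 v.2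
      simp only [oddsBelow, mem_filter, mem_univ, true_and, mem_singleton, eq1]
      constructor
      · rintro ⟨h1, h2⟩
        grind
      · intro h
        rw [h]
        exact ⟨by omega, odd_one⟩
    rw [e1, e2, e3, card_empty, Nat.cast_zero] at h4
    rw [e1, e2] at h3
    have hv2 : v₂ ∉ ({v₁} : Finset (Icc 1 (2 * n))) := by
      rw [mem_singleton, eq1]
      change ¬ 2 = 1
      omega
    have h5 := h4.append (l' := [v₂]) ⟨_, integral_proper_even (isIntegral_sumIntegral (Fin t))
      hv2 subset_rfl (fun u hu => ?_) _, rfl⟩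
    · rw [natCard_proper_of_iteratedIntegral G {v₁} t x₀ ?_ ?_ h5, if_pos, image_singleton,
        card_singleton, Fintype.card_fin, Nat.cast_one]
      · intro u hu w hw huw
        rw [mem_singleton.1 hu, mem_singleton.1 hw] at huw
        exact absurd huw G.irrefl
      · rw [List.nodup_append]
        refine ⟨h1, List.nodup_singleton _, fun a ha b hb => ?_⟩
        rw [List.mem_singleton.1 hb]
        rintro rfl
        exact ((h3 _).1 ha).2 (by simp)
      · intro v
        rw [List.mem_append, h3, List.mem_singleton, mem_singleton]
        simp only [mem_univ, true_and, mem_insert, mem_singleton]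
        have : v = v₂ → v ≠ v₁ := by
          rintro rfl
          simpa using hv2
        tauto
    · rw [mem_singleton] at hu ⊢
      rw [hu]
      simp only [iff_true]
      exact (hadj1 v₂ even_two).symm
  · exact fun π => ⟨fun _ => hsep _, fun _ => ⟨π, rfl⟩⟩
  · refine ⟨⟨⊤, hconn⟩, ?_⟩
    change Nat.card (Quotient (⊤ : Setoid (Icc 1 (2 * n)))) = _
    rw [card_singleton, Nat.card_eq_one_iff_unique]
    refine ⟨⟨fun p q => Quotient.inductionOn₂ p q fun a b => Quotient.sound trivial⟩,
      ⟨Quotient.mk _ v₁⟩⟩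

theorem charPoly_L_eq {n : ℕ} (hn : 2 ≤ n) :
    charPoly (L n hn) = (roundOp (Polynomial.X : Polynomial ℤ) 1)^[n - 2] (fun _ => 1) 1 := by
  refine Polynomial.eq_of_infinite_eval_eq _ _ (Set.Infinite.mono (s := Set.range
    fun m : ℕ => ((m + 2 : ℕ) : ℤ)) ?_ (Set.infinite_range_of_injective fun a b h => ?_))
  · rintro _ ⟨m, rfl⟩
    have h := map_iterate_roundOp (Polynomial.evalRingHom ((m + 2 : ℕ) : ℤ)) Polynomial.X 1
      (n - 2) 1
    simp only [Polynomial.coe_evalRingHom, Polynomial.eval_X, Polynomial.eval_one] at h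
    exact (eval_charPoly_L hn (m + 2) (by omega)).trans h.symm
  · simpa using h

theorem eval_charPoly_L_eq {n : ℕ} (hn : 2 ≤ n) (T : ℤ) :
    (charPoly (L n hn)).eval T = (roundOp T 1)^[n - 2] (fun _ => 1) 1 := by
  have h := map_iterate_roundOp (Polynomial.evalRingHom T) Polynomial.X 1 (n - 2) 1
  simp only [Polynomial.coe_evalRingHom, Polynomial.eval_X, Polynomial.eval_one] at h
  rw [charPoly_L_eq, h]

theorem charPoly_L_mul {n : ℕ} (hn : 2 ≤ n) :
    (Polynomial.X - 1) ^ 3 * charPoly (L n hn) =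
      charPoly (BondLattice (Gam (Icc 1 (2 * n)))) := by
  refine Polynomial.eq_of_infinite_eval_eq _ _ (Set.Infinite.mono (s := Set.range
    fun m : ℕ => ((m + 1 : ℕ) : ℤ)) ?_ (Set.infinite_range_of_injective fun a b h => ?_))
  · rintro _ ⟨m, rfl⟩
    have h := iterate_succ_roundOp_zero_one ((m + 1 : ℕ) : ℤ) (n - 2)
    rw [show n - 2 + 1 = n - 1 by omega] at h
    have h2 := eval_charPoly_bondLattice (n := n) (by omega) (m + 1) (by omega)
    rw [h] at h2
    refine Eq.trans ?_ h2.symm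
    rw [Polynomial.eval_mul, eval_charPoly_L_eq]
    simp only [Polynomial.eval_pow, Polynomial.eval_sub, Polynomial.eval_X, Polynomial.eval_one]
    ring
  · simpa using h

/-! ### Integration over the line with respect to the Euler characteristic -/

section Euler

open Filter Topology

/-- `e` is the integral of the step function `h` with respect to the Euler characteristic for
which points and the whole line have measure `1`, open bounded intervals `-1`, and open rays `0`:
the sum of the value of `h` at `+∞` and of the differences between the values of `h` and its right
limits. -/
def EulerIntegral (h : ℝ → ℤ) (e : ℤ) : Prop :=
  ∃ (r : ℝ → ℤ) (c : ℤ), (∀ p, ∀ᶠ y in 𝓝[>] p, h y = r p) ∧ (∀ᶠ y in atTop, h y = c) ∧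
    (Function.support fun p => h p - r p).Finite ∧ e = c + ∑ᶠ p, (h p - r p)

theorem isIntegral_eulerIntegral : IsIntegral EulerIntegral 1 where
  unique := by
    rintro h _ _ ⟨r, c, h1, h2, -, rfl⟩ ⟨r', c', h1', h2', -, rfl⟩
    obtain rfl : r = r' := funext fun p => by
      obtain ⟨y, hy, hy'⟩ := ((h1 p).and (h1' p)).exists
      exact hy.symm.trans hy'
    obtain ⟨y, hy, hy'⟩ := (h2.and h2').exists
    rw [← hy, ← hy']
  add := by
    rintro h _ h' _ ⟨r, c, h1, h2, h3, rfl⟩ ⟨r', c', h1', h2', h3', rfl⟩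
    have e1 : ∀ p, (h + h') p - (r + r') p = (h p - r p) + (h' p - r' p) := fun p => by
      simp only [Pi.add_apply]
      ring
    refine ⟨r + r', c + c', fun p => ?_, ?_, ?_, ?_⟩
    · filter_upwards [h1 p, h1' p] with y hy hy'
      simp [hy, hy']
    · filter_upwards [h2, h2'] with y hy hy'
      simp [hy, hy']
    · simp only [e1]
      exact (h3.union h3').subset (Function.support_add _ _)
    · simp only [e1]
      rw [finsum_add_distrib h3 h3']
      ring
  const_mul := by
    rintro a h _ ⟨r, c, h1, h2, h3, rfl⟩
    refine ⟨fun p => a * r p, a * c, fun p => ?_, ?_, ?_, ?_⟩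
    · filter_upwards [h1 p] with y hy
      rw [hy]
    · filter_upwards [h2] with y hy
      rw [hy]
    · simp only [← mul_sub]
      exact h3.subset (Function.support_mul_subset_right _ _)
    · simp only [← mul_sub]
      rw [← mul_finsum, mul_add]
  of_const_off := by
    intro D c h hc
    have hsupp : (Function.support fun p => h p - c) ⊆ D := by
      intro p hp
      by_contra hpD
      exact hp (sub_eq_zero.2 (hc p hpD))
    refine ⟨fun _ => c, c, fun p => ?_, ?_, D.finite_toSet.subset hsupp, ?_⟩
    · have h1 : ∀ᶠ y in 𝓝[>] p, ∀ d ∈ D, y ≠ d := by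
        rw [Filter.eventually_all_finset]
        intro d _
        rcases le_or_gt d p with hd | hd
        · filter_upwards [self_mem_nhdsWithin] with y hy
          exact (lt_of_le_of_lt hd hy).ne'
        · filter_upwards [mem_nhdsWithin_of_mem_nhds (Iio_mem_nhds hd)] with y hy
          exact ne_of_lt hy
      filter_upwards [h1] with y hy
      exact hc y fun hyD => hy y hyD rfl
    · have h1 : ∀ᶠ y : ℝ in atTop, ∀ d ∈ D, y ≠ d := by
        rw [Filter.eventually_all_finset]
        exact fun d _ => eventually_ne_atTop d
      filter_upwards [h1] with y hy
      exact hc y fun hyD => hy y hyD rfl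
    · rw [finsum_eq_sum_of_support_subset _ hsupp, mul_one]

theorem eulerIntegral_Ioi (a : ℝ) : EulerIntegral (fun y => if a < y then 1 else 0) 0 := by
  have hs : (Function.support fun p : ℝ =>
      ((if a < p then 1 else 0) - (if a ≤ p then 1 else 0) : ℤ)) ⊆ ({a} : Finset ℝ) := by
    intro p hp
    rw [coe_singleton, Set.mem_singleton_iff]
    by_contra hne
    refine hp ?_
    rcases lt_or_gt_of_ne hne with h | h
    · simp [h.not_gt, h.not_ge]
    · simp [h, h.le]
  refine ⟨fun p => if a ≤ p then 1 else 0, 1, fun p => ?_, ?_,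
    (finite_toSet _).subset hs, ?_⟩
  · rcases le_or_gt a p with h | h
    · filter_upwards [self_mem_nhdsWithin] with y hy
      rw [if_pos h, if_pos (lt_of_le_of_lt h hy)]
    · filter_upwards [mem_nhdsWithin_of_mem_nhds (Iio_mem_nhds h)] with y hy
      rw [if_neg h.not_ge, if_neg (not_lt.2 (le_of_lt hy))]
  · filter_upwards [eventually_gt_atTop a] with y hy
    rw [if_pos hy]
  · rw [finsum_eq_sum_of_support_subset _ hs]
    simp only [sum_singleton, lt_self_iff_false, le_refl, if_true, if_false]
    norm_num

theorem eulerIntegral_Iio (b : ℝ) : EulerIntegral (fun y => if y < b then 1 else 0) 0 := by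
  refine ⟨fun p => if p < b then 1 else 0, 0, fun p => ?_, ?_, by simp, by simp⟩
  · rcases lt_or_ge p b with h | h
    · filter_upwards [mem_nhdsWithin_of_mem_nhds (Iio_mem_nhds h)] with y hy
      rw [if_pos h, if_pos (show y < b from hy)]
    · filter_upwards [self_mem_nhdsWithin] with y hy
      rw [if_neg h.not_gt, if_neg (not_lt.2 (h.trans (le_of_lt hy)))]
  · filter_upwards [eventually_ge_atTop b] with y hy
    rw [if_neg hy.not_gt]

theorem eulerIntegral_Ioo {a b : ℝ} (hab : a < b) :
    EulerIntegral (fun y => if a < y ∧ y < b then 1 else 0) (-1) := by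
  have hE := isIntegral_eulerIntegral
  have h := hE.add (hE.add (eulerIntegral_Ioi a) (eulerIntegral_Iio b))
    (hE.of_const_off ∅ (-1) (fun _ => -1) fun _ _ => rfl)
  simp only [sum_empty] at h
  convert h using 1
  swap
  · norm_num
  funext y
  simp only [Pi.add_apply]
  by_cases h1 : a < y <;> by_cases h2 : y < b <;> simp [h1, h2]
  exact h2 (lt_of_le_of_lt (not_lt.1 h1) hab)

end Euler

/-! ### Regions of a graphic arrangement -/

section Region

variable {V : Type*} [DecidableEq V]

/-- `x` respects the relation `r` on `S`. -/
def Respects (r : V → V → Prop) (S : Finset V) (x : V → ℝ) : Prop :=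
  ∀ i ∈ S, ∀ j ∈ S, r i j → x i < x j

open Classical in
/-- The indicator function of the cone of a relation. -/
def coneIndicator (r : V → V → Prop) (S : Finset V) (x : V → ℝ) : ℤ :=
  if Respects r S x then 1 else 0

theorem respects_insert_update {r : V → V → Prop} (hirr : ∀ i, ¬ r i i) {S : Finset V} {v : V}
    (hv : v ∉ S) (x : V → ℝ) (y : ℝ) :
    Respects r (insert v S) (Function.update x v y) ↔
      Respects r S x ∧ (∀ i ∈ S, r i v → x i < y) ∧ ∀ j ∈ S, r v j → y < x j := by
  have hne : ∀ u ∈ S, Function.update x v y u = x u := fun u hu =>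
    Function.update_of_ne (ne_of_mem_of_not_mem hu hv) _ _
  constructor
  · intro h
    refine ⟨fun i hi j hj hij => ?_, fun i hi hiv => ?_, fun j hj hvj => ?_⟩
    · have := h i (mem_insert_of_mem hi) j (mem_insert_of_mem hj) hij
      rwa [hne i hi, hne j hj] at this
    · have := h i (mem_insert_of_mem hi) v (mem_insert_self _ _) hiv
      rwa [hne i hi, Function.update_self] at this
    · have := h v (mem_insert_self _ _) j (mem_insert_of_mem hj) hvj
      rwa [hne j hj, Function.update_self] at this
  · rintro ⟨h1, h2, h3⟩ i hi j hj hij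
    rcases mem_insert.1 hi with rfl | hi' <;> rcases mem_insert.1 hj with rfl | hj'
    · exact absurd hij (hirr _)
    · rw [hne j hj', Function.update_self]
      exact h3 j hj' hij
    · rw [hne i hi', Function.update_self]
      exact h2 i hi' hij
    · rw [hne i hi', hne j hj']
      exact h1 i hi' j hj' hij

open Classical in
/-- Integrating out a coordinate of the cone of a strict partial order gives, up to sign, the cone
of the induced order, or zero if the coordinate is bounded on one side only. -/
theorem eulerIntegral_coneIndicator {r : V → V → Prop} (hirr : ∀ i, ¬ r i i)
    (htrans : ∀ i j k, r i j → r j k → r i k) {S : Finset V} {v : V} (hv : v ∉ S)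
    (hcomp : ∃ i ∈ S, r i v ∨ r v i) (x : V → ℝ) :
    EulerIntegral (fun y => coneIndicator r (insert v S) (Function.update x v y))
      ((if (∃ i ∈ S, r i v) ∧ ∃ j ∈ S, r v j then -1 else 0) * coneIndicator r S x) := by
  simp only [coneIndicator, respects_insert_update hirr hv]
  by_cases hx : Respects r S x
  swap
  · simpa only [hx, false_and, if_false, mul_zero] using isIntegral_eulerIntegral.zero
  simp only [hx, true_and, if_true, mul_one]
  have hlow : (∃ i ∈ S, r i v) → ∃ i ∈ S, r i v ∧ ∀ y, (∀ j ∈ S, r j v → x j < y) ↔ x i < y := by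
    rintro ⟨i, hi, hiv⟩
    obtain ⟨k, hk, hmax⟩ := exists_max_image {i ∈ S | r i v} x ⟨i, mem_filter.2 ⟨hi, hiv⟩⟩
    rw [mem_filter] at hk
    exact ⟨k, hk.1, hk.2, fun y => ⟨fun h => h k hk.1 hk.2, fun h j hj hjv =>
      lt_of_le_of_lt (hmax j (mem_filter.2 ⟨hj, hjv⟩)) h⟩⟩
  have hup : (∃ i ∈ S, r v i) → ∃ i ∈ S, r v i ∧ ∀ y, (∀ j ∈ S, r v j → y < x j) ↔ y < x i := by
    rintro ⟨i, hi, hiv⟩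
    obtain ⟨k, hk, hmin⟩ := exists_min_image {i ∈ S | r v i} x ⟨i, mem_filter.2 ⟨hi, hiv⟩⟩
    rw [mem_filter] at hk
    exact ⟨k, hk.1, hk.2, fun y => ⟨fun h => h k hk.1 hk.2, fun h j hj hjv =>
      lt_of_lt_of_le h (hmin j (mem_filter.2 ⟨hj, hjv⟩))⟩⟩
  by_cases hl : ∃ i ∈ S, r i v <;> by_cases hu : ∃ j ∈ S, r v j
  · obtain ⟨i, hi, hiv, hi'⟩ := hlow hl
    obtain ⟨j, hj, hvj, hj'⟩ := hup hu
    rw [if_pos ⟨hl, hu⟩]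
    simp only [hi', hj']
    exact eulerIntegral_Ioo (hx i hi j hj (htrans _ _ _ hiv hvj))
  · obtain ⟨i, hi, hiv, hi'⟩ := hlow hl
    rw [if_neg fun h => hu h.2]
    push Not at hu
    have : ∀ y, (∀ j ∈ S, r v j → y < x j) ↔ True := fun y =>
      iff_true_intro fun j hj hvj => absurd hvj (hu j hj)
    simp only [hi', this, and_true]
    exact eulerIntegral_Ioi _
  · obtain ⟨j, hj, hvj, hj'⟩ := hup hu
    rw [if_neg fun h => hl h.1]
    push Not at hl
    have : ∀ y, (∀ j ∈ S, r j v → x j < y) ↔ True := fun y =>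
      iff_true_intro fun j hj hvj => absurd hvj (hl j hj)
    simp only [hj', this, true_and]
    exact eulerIntegral_Iio _
  · obtain ⟨i, hi, h | h⟩ := hcomp
    · exact absurd ⟨i, hi, h⟩ hl
    · exact absurd ⟨i, hi, h⟩ hu

open Classical in
/-- Integrating out the coordinates in `l` of the cone of a strict partial order, each of them
comparable with `s` or `t`: the result is nonzero only if all of them lie between `t` and `s`,
because a coordinate with a lower and an upper bound among coordinates between `t` and `s` is
itself between `t` and `s`. -/
theorem exists_iteratedIntegral_coneIndicator {r : V → V → Prop} (hirr : ∀ i, ¬ r i i)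
    (htrans : ∀ i j k, r i j → r j k → r i k) {s t : V} (l : List V) (hl : l.Nodup)
    (hst : ∀ v ∈ l, v ∉ ({s, t} : Finset V))
    (hcomp : ∀ v ∈ l, ∃ i ∈ ({s, t} : Finset V), r i v ∨ r v i) :
    ∃ c : ℤ, IteratedIntegral EulerIntegral l (coneIndicator r (l.toFinset ∪ {s, t}))
        (fun x => c * coneIndicator r {s, t} x) ∧
      (r t s → c = if ∀ v ∈ l, r t v ∧ r v s then (-1) ^ l.length else 0) := by
  induction l with
  | nil =>
    refine ⟨1, ?_, fun _ => by simp⟩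
    funext x
    simp
  | cons v l ih =>
    rw [List.nodup_cons] at hl
    obtain ⟨c, h1, h2⟩ := ih hl.2 (fun w hw => hst w (List.mem_cons_of_mem _ hw))
      (fun w hw => hcomp w (List.mem_cons_of_mem _ hw))
    have hv : v ∉ l.toFinset ∪ {s, t} := by
      rw [mem_union, not_or, List.mem_toFinset]
      exact ⟨hl.1, hst v List.mem_cons_self⟩
    obtain ⟨i, hi, hiv⟩ := hcomp v List.mem_cons_self
    have hstep := eulerIntegral_coneIndicator hirr htrans hv ⟨i, mem_union_right _ hi, hiv⟩
    set S := l.toFinset ∪ {s, t} with hS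
    set a : ℤ := if (∃ i ∈ S, r i v) ∧ ∃ j ∈ S, r v j then -1 else 0 with ha
    refine ⟨a * c, ⟨fun x => a * coneIndicator r S x, ?_, ?_⟩, fun hts => ?_⟩
    · rw [List.toFinset_cons, insert_union]
      exact hstep
    · simp only [mul_assoc]
      exact h1.const_mul isIntegral_eulerIntegral a
    · rw [h2 hts, ha]
      simp only [List.forall_mem_cons, List.length_cons]
      by_cases hall : ∀ w ∈ l, r t w ∧ r w s
      · have hlow : (∃ i ∈ S, r i v) ↔ r t v := by
          constructor
          · rintro ⟨i, hi, hiv⟩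
            simp only [hS, mem_union, List.mem_toFinset, mem_insert, mem_singleton] at hi
            rcases hi with hi | rfl | rfl
            · exact htrans _ _ _ (hall i hi).1 hiv
            · exact htrans _ _ _ hts hiv
            · exact hiv
          · exact fun h => ⟨t, by simp [hS], h⟩
        have hup : (∃ i ∈ S, r v i) ↔ r v s := by
          constructor
          · rintro ⟨i, hi, hiv⟩
            simp only [hS, mem_union, List.mem_toFinset, mem_insert, mem_singleton] at hi
            rcases hi with hi | rfl | rfl
            · exact htrans _ _ _ hiv (hall i hi).2
            · exact hiv
            · exact htrans _ _ _ hiv hts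
          · exact fun h => ⟨s, by simp [hS], h⟩
        rw [if_pos hall]
        by_cases hb : r t v ∧ r v s
        · rw [if_pos ⟨hlow.2 hb.1, hup.2 hb.2⟩, if_pos ⟨hb, hall⟩]
          ring
        · rw [if_neg (fun h => hb ⟨hlow.1 h.1, hup.1 h.2⟩),
            if_neg (fun h : _ ∧ _ => hb h.1), zero_mul]
      · rw [if_neg hall, if_neg (c := (r t v ∧ r v s) ∧ ∀ w ∈ l, r t w ∧ r w s)
          (fun h => hall h.2), mul_zero]

end Region

section Orient

variable {V : Type*} {G : SimpleGraph V}

/-- The transitive closure of the orientation of `G` by increasing values of `x`. -/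
def orient (G : SimpleGraph V) (x : V → ℝ) : V → V → Prop :=
  Relation.TransGen fun i j => G.Adj i j ∧ x i < x j

theorem lt_of_orient {x : V → ℝ} {i j : V} (h : orient G x i j) : x i < x j := by
  induction h with
  | single h => exact h.2
  | tail _ h ih => exact ih.trans h.2

theorem orient_irrefl (x : V → ℝ) (i : V) : ¬ orient G x i i := fun h => lt_irrefl _ (lt_of_orient h)

theorem orient_trans (x : V → ℝ) (i j k : V) (h : orient G x i j) (h' : orient G x j k) :
    orient G x i k := Relation.TransGen.trans h h'

theorem orient_of_adj {x : V → ℝ} {i j : V} (h : G.Adj i j) (hlt : x i < x j) : orient G x i j :=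
  Relation.TransGen.single ⟨h, hlt⟩

theorem orient_congr {x y : V → ℝ} (h : ∀ i j, G.Adj i j → (x i < x j ↔ y i < y j)) :
    orient G x = orient G y := by
  unfold orient
  congr 1
  funext i j
  exact propext (and_congr_right fun hij => h i j hij)

variable [Fintype V]

theorem respects_orient_iff {x y : V → ℝ} (hx : Proper G univ x) :
    Respects (orient G x) univ y ↔ Proper G univ y ∧ orient G y = orient G x := by
  constructor
  · intro h
    have hlt : ∀ i j, G.Adj i j → x i < x j → y i < y j := fun i j hij hlt =>
      h i (mem_univ _) j (mem_univ _) (orient_of_adj hij hlt)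
    refine ⟨fun i _ j _ hij => ?_, orient_congr fun i j hij => ⟨fun hy => ?_, hlt i j hij⟩⟩
    · rcases lt_or_gt_of_ne (hx i (mem_univ _) j (mem_univ _) hij) with h' | h'
      · exact (hlt i j hij h').ne
      · exact (hlt j i hij.symm h').ne'
    · rcases lt_or_gt_of_ne (hx i (mem_univ _) j (mem_univ _) hij) with h' | h'
      · exact h'
      · exact absurd hy (hlt j i hij.symm h').not_gt
  · rintro ⟨-, h⟩ i _ j _ hij
    rw [← h] at hij
    exact lt_of_orient hij

/-- The strict partial orders that correspond to the regions of the graphic arrangement of `G`. -/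
def regionOrders (G : SimpleGraph V) : Finset (V → V → Prop) :=
  (Set.toFinite (orient G '' {x | Proper G univ x})).toFinset

theorem mem_regionOrders {r : V → V → Prop} :
    r ∈ regionOrders G ↔ ∃ x, Proper G univ x ∧ orient G x = r := by
  simp [regionOrders]

open Classical in
theorem ite_proper_eq_sum (y : V → ℝ) :
    (if Proper G univ y then 1 else 0 : ℤ) = ∑ r ∈ regionOrders G, coneIndicator r univ y := by
  have h : ∀ r ∈ regionOrders G, coneIndicator r univ y =
      if r = orient G y then (if Proper G univ y then 1 else 0) else 0 := by
    intro r hr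
    obtain ⟨x, hx, rfl⟩ := mem_regionOrders.1 hr
    by_cases h1 : orient G y = orient G x <;> by_cases h2 : Proper G univ y <;>
      simp [coneIndicator, respects_orient_iff hx, eq_comm (a := orient G x), h1, h2]
  rw [sum_congr rfl h, sum_ite_eq']
  by_cases h2 : Proper G univ y
  · rw [if_pos (mem_regionOrders.2 ⟨y, h2, rfl⟩)]
  · simp [h2]

end Orient

open Classical in
/-- The regions in which all coordinates lie between those of `2n` and of `1`. -/
theorem card_regionOrders_between {n : ℕ} (hn : 2 ≤ n) :
    (#{r ∈ regionOrders (Gam (redVerts n)) | r (vLast n hn) (vFirst n hn) ∧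
      ∀ v, v ≠ vFirst n hn → v ≠ vLast n hn → r (vLast n hn) v ∧ r v (vFirst n hn)} : ℤ) =
      (roundOp (1 : ℤ) 1)^[n - 2] (fun _ => 1) 1 := by
  set s := vFirst n hn with hs
  set t := vLast n hn with ht
  have hst : s ≠ t := vFirst_ne_vLast hn
  have hadj : (Gam (redVerts n)).Adj s t := gam_adj_vFirst hn (even_two_mul n)
  obtain ⟨l, h1, h2, h3, h4⟩ := exists_iteratedIntegral_redVerts hn isIntegral_eulerIntegral
  have hS : l.toFinset ∪ {s, t} = univ := by
    ext v
    simp only [mem_union, List.mem_toFinset, h3, mem_univ, iff_true]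
    exact (Classical.em _).symm
  have hint : ∀ r ∈ regionOrders (Gam (redVerts n)), ∃ c : ℤ,
      IteratedIntegral EulerIntegral l (coneIndicator r univ)
        (fun x => c * coneIndicator r {s, t} x) ∧
      (r t s → c = if ∀ v ∈ l, r t v ∧ r v s then 1 else 0) := by
    intro r hr
    obtain ⟨x, hx, rfl⟩ := mem_regionOrders.1 hr
    have hcomp : ∀ u v, (Gam (redVerts n)).Adj u v →
        orient (Gam (redVerts n)) x u v ∨ orient (Gam (redVerts n)) x v u := by
      intro u v huv
      rcases lt_or_gt_of_ne (hx u (mem_univ _) v (mem_univ _) huv) with h | h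
      · exact Or.inl (orient_of_adj huv h)
      · exact Or.inr (orient_of_adj huv.symm h)
    obtain ⟨c, hc1, hc2⟩ := exists_iteratedIntegral_coneIndicator (r := orient (Gam (redVerts n)) x)
      (orient_irrefl x) (orient_trans x) (s := s) (t := t) l h1 (fun v hv => (h3 v).1 hv) (by
        intro v _
        rcases Nat.even_or_odd v.1 with hv | hv
        · exact ⟨s, by simp, hcomp _ _ (gam_adj_vFirst hn hv)⟩
        · exact ⟨t, by simp, hcomp _ _ (gam_adj_vLast hn hv)⟩)
    rw [hS] at hc1
    refine ⟨c, hc1, fun h => ?_⟩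
    rw [hc2 h, h2, pow_mul]
    simp
  choose! c hc1 hc2 using hint
  have hsum := IteratedIntegral.sum isIntegral_eulerIntegral _ hc1
  simp only [← ite_proper_eq_sum] at hsum
  let x : redVerts n → ℝ := fun v => if v = s then 1 else 0
  have hxs : x s = 1 := if_pos rfl
  have hxt : x t = 0 := if_neg hst.symm
  have hval := congrFun (h4.unique isIntegral_eulerIntegral hsum) x
  rw [if_neg (by rw [hxs, hxt]; norm_num)] at hval
  rw [hval, card_filter]
  push_cast
  refine sum_congr rfl fun r hr => ?_
  by_cases hts : r t s
  · have hcone : coneIndicator r {s, t} x = 1 := by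
      obtain ⟨y, -, rfl⟩ := mem_regionOrders.1 hr
      refine if_pos fun i hi j hj hij => ?_
      rw [mem_insert, mem_singleton] at hi hj
      rcases hi with rfl | rfl <;> rcases hj with rfl | rfl
      · exact absurd hij (orient_irrefl _ _)
      · exact absurd (orient_trans _ _ _ _ hij hts) (orient_irrefl _ _)
      · rw [hxs, hxt]
        exact one_pos
      · exact absurd hij (orient_irrefl _ _)
    rw [hcone, mul_one, hc2 r hr hts]
    refine if_congr ?_ rfl rfl
    simp only [h3, mem_insert, mem_singleton, not_or, and_imp, hs, ht]
    exact and_iff_right hts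
  · have hcone : coneIndicator r {s, t} x = 0 := by
      obtain ⟨y, hy, rfl⟩ := mem_regionOrders.1 hr
      refine if_neg fun h => ?_
      rcases lt_or_gt_of_ne (hy s (mem_univ _) t (mem_univ _) hadj) with h' | h'
      · have := h s (by simp) t (by simp) (orient_of_adj hadj h')
        rw [hxs, hxt] at this
        exact absurd this (by norm_num)
      · exact hts (orient_of_adj hadj.symm h')
    rw [hcone, mul_zero, if_neg fun h => hts h.1]

/-! ### Bounded regions of the affine arrangement -/

section Bounded

variable {n : ℕ} (hn : 2 ≤ n)

theorem mem_slice {x : redVerts n → ℝ} :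
    x ∈ slice n hn ↔ x (vFirst n hn) - x (vLast n hn) = 1 := Iff.rfl

theorem mem_complement_iff {x : redVerts n → ℝ} :
    x ∈ complement (slice n hn) (arrP n hn) ↔
      x ∈ slice n hn ∧ Proper (Gam (redVerts n)) univ x := by
  refine and_congr_right fun hx => ⟨fun h i _ j _ hij heq => ?_, ?_⟩
  · have hmem : x ∈ diffHyperplane i j 0 ⊓ slice n hn :=
      ⟨show x i - x j = 0 from sub_eq_zero.2 heq, hx⟩
    refine h _ ⟨fun hbot => ?_, _, ⟨i, j, hij, rfl⟩, rfl⟩ hmem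
    rw [hbot] at hmem
    exact hmem
  · rintro h _ ⟨-, _, ⟨i, j, hij, rfl⟩, rfl⟩ hmem
    exact h i (mem_univ _) j (mem_univ _) hij (sub_eq_zero.1 (show x i - x j = 0 from hmem.1))

/-- The intersection with the slice `x_1 = x_{2n} + 1` of the cone of a relation. -/
def sliceCone (r : redVerts n → redVerts n → Prop) : Set (redVerts n → ℝ) :=
  {x | x ∈ slice n hn ∧ Respects r univ x}

theorem convex_sliceCone (r : redVerts n → redVerts n → Prop) : Convex ℝ (sliceCone hn r) := by
  rintro x ⟨hx, hx'⟩ y ⟨hy, hy'⟩ a b ha hb hab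
  rw [mem_slice] at hx hy
  refine ⟨?_, fun i hi j hj hij => ?_⟩
  · rw [mem_slice]
    simp only [Pi.add_apply, Pi.smul_apply, smul_eq_mul]
    linear_combination a * hx + b * hy + hab
  · have h1 := hx' i hi j hj hij
    have h2 := hy' i hi j hj hij
    simp only [Pi.add_apply, Pi.smul_apply, smul_eq_mul]
    rcases ha.eq_or_lt with rfl | ha'
    · have : b = 1 := by linarith
      subst this
      linarith
    · nlinarith [mul_lt_mul_of_pos_left h1 ha', mul_le_mul_of_nonneg_left h2.le hb]

theorem connectedComponentIn_complement {x : redVerts n → ℝ}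
    (hx : x ∈ complement (slice n hn) (arrP n hn)) :
    connectedComponentIn (complement (slice n hn) (arrP n hn)) x =
      sliceCone hn (orient (Gam (redVerts n)) x) := by
  have hx2 := (mem_complement_iff hn).1 hx
  have hsub : sliceCone hn (orient (Gam (redVerts n)) x) ⊆
      complement (slice n hn) (arrP n hn) := fun y hy =>
    (mem_complement_iff hn).2 ⟨hy.1, ((respects_orient_iff hx2.2).1 hy.2).1⟩
  refine Set.Subset.antisymm (fun y hy => ?_) ?_
  · have hy1 := (mem_complement_iff hn).1 (connectedComponentIn_subset _ _ hy)
    refine ⟨hy1.1, (respects_orient_iff hx2.2).2 ⟨hy1.2, ?_⟩⟩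
    have key : ∀ i j, (Gam (redVerts n)).Adj i j → x i < x j → y i < y j := by
      intro i j hij hlt
      have hc := (isPreconnected_connectedComponentIn
        (F := complement (slice n hn) (arrP n hn)) (x := x)).subset_left_of_subset_union
        (u := {z : redVerts n → ℝ | z i < z j}) (v := {z : redVerts n → ℝ | z j < z i})
        (isOpen_lt (continuous_apply i) (continuous_apply j))
        (isOpen_lt (continuous_apply j) (continuous_apply i))
        (Set.disjoint_left.2 fun z (hz : z i < z j) hz' => lt_asymm hz hz') (fun z hz => ?_)
        ⟨x, mem_connectedComponentIn hx, hlt⟩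
      · exact hc hy
      · have hz1 := (mem_complement_iff hn).1 (connectedComponentIn_subset _ _ hz)
        exact lt_or_gt_of_ne (hz1.2 i (mem_univ _) j (mem_univ _) hij)
    refine orient_congr fun i j hij => ⟨fun h => ?_, key i j hij⟩
    rcases lt_or_gt_of_ne (hx2.2 i (mem_univ _) j (mem_univ _) hij) with h' | h'
    · exact h'
    · exact absurd h (key j i hij.symm h').not_gt
  · exact (convex_sliceCone hn _).isPreconnected.subset_connectedComponentIn
      ⟨hx2.1, (respects_orient_iff hx2.2).2 ⟨hx2.2, rfl⟩⟩ hsub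

theorem const_mem_lineality (a : ℝ) :
    (fun _ => a) ∈ lineality (slice n hn) (arrP n hn) := by
  have hE : ∀ p ∈ slice n hn, (fun _ => a) + p ∈ slice n hn := by
    intro p hp
    rw [mem_slice] at hp ⊢
    simp only [Pi.add_apply]
    linear_combination hp
  refine Submodule.mem_inf.2 ⟨?_, ?_⟩
  · let p : redVerts n → ℝ := fun v => if v = vFirst n hn then 1 else 0
    have hp : p ∈ slice n hn := by
      rw [mem_slice]
      simp [p, (vFirst_ne_vLast hn).symm]
    have := AffineSubspace.vsub_mem_direction (hE p hp) hp
    rwa [vsub_eq_sub, add_sub_cancel_right] at this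
  · rw [Submodule.mem_iInf]
    intro K
    rw [Submodule.mem_iInf]
    rintro ⟨hK, _, ⟨i, j, hij, rfl⟩, rfl⟩
    obtain ⟨p, hp⟩ := (AffineSubspace.nonempty_iff_ne_bot _).2 hK
    have hp' : (fun _ => a) + p ∈ diffHyperplane i j 0 ⊓ slice n hn := by
      refine ⟨?_, hE p hp.2⟩
      have h1 : p i - p j = 0 := hp.1
      change (a + p i) - (a + p j) = 0
      linear_combination h1
    have := AffineSubspace.vsub_mem_direction hp' hp
    rwa [vsub_eq_sub, add_sub_cancel_right] at this

theorem eq_of_mem_lineality {w : redVerts n → ℝ} (hw : w ∈ lineality (slice n hn) (arrP n hn))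
    (v : redVerts n) : w v = w (vFirst n hn) := by
  obtain ⟨hE, hA⟩ := Submodule.mem_inf.1 hw
  -- An edge other than `{1, 2n}` gives a hyperplane that meets the slice in a point `p`.
  have hedge : ∀ i j (p : redVerts n → ℝ), (Gam (redVerts n)).Adj i j → p ∈ slice n hn →
      p i = p j → w i = w j := by
    intro i j p hij hp hpij
    have hmem : p ∈ diffHyperplane i j 0 ⊓ slice n hn :=
      ⟨show p i - p j = 0 from sub_eq_zero.2 hpij, hp⟩
    have hK : diffHyperplane i j 0 ⊓ slice n hn ∈ arrP n hn :=
      ⟨(AffineSubspace.nonempty_iff_ne_bot _).1 ⟨p, hmem⟩, _, ⟨i, j, hij, rfl⟩, rfl⟩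
    have h1 := (Submodule.mem_iInf _).1 ((Submodule.mem_iInf _).1 hA _) hK
    have h2 := (AffineSubspace.vadd_mem_of_mem_direction h1 hmem).1
    have h3 : (w i + p i) - (w j + p j) = 0 := h2
    linear_combination h3 - hpij
  have hst : w (vLast n hn) = w (vFirst n hn) := by
    let p : redVerts n → ℝ := fun v => if v = vFirst n hn then 1 else 0
    have hp : p ∈ slice n hn := by
      rw [mem_slice]
      simp [p, (vFirst_ne_vLast hn).symm]
    have h1 := AffineSubspace.vadd_mem_of_mem_direction hE hp
    have h2 : (w (vFirst n hn) + p (vFirst n hn)) - (w (vLast n hn) + p (vLast n hn)) = 1 := h1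
    have h3 : p (vFirst n hn) - p (vLast n hn) = 1 := hp
    linear_combination h3 - h2
  by_cases hvt : v = vLast n hn
  · rw [hvt, hst]
  by_cases hvs : v = vFirst n hn
  · rw [hvs]
  rcases Nat.even_or_odd v.1 with hv | hv
  · refine (hedge _ _ (fun u => if u = vLast n hn then -1 else 0) (gam_adj_vFirst hn hv)
      ?_ ?_).symm
    · rw [mem_slice]
      simp [vFirst_ne_vLast hn]
    · simp [vFirst_ne_vLast hn, hvt]
  · rw [← hst]
    refine (hedge _ _ (fun u => if u = vFirst n hn then 1 else 0) (gam_adj_vLast hn hv)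
      ?_ ?_).symm
    · rw [mem_slice]
      simp [(vFirst_ne_vLast hn).symm]
    · simp [(vFirst_ne_vLast hn).symm, hvs]

/-- A region that recedes in a direction not constant on the vertices is unbounded. -/
theorem not_relativelyBounded_of_direction {r : redVerts n → redVerts n → Prop}
    {x d : redVerts n → ℝ} (hx : x ∈ sliceCone hn r) (hd : ∀ i j, r i j → d i ≤ d j)
    (hs : d (vFirst n hn) = 0) (ht : d (vLast n hn) = 0) {v : redVerts n} (hv : d v ≠ 0) :
    ¬ RelativelyBounded (slice n hn) (arrP n hn) (sliceCone hn r) := by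
  rintro ⟨B, hB, hxB⟩
  have hbd : ∀ u : redVerts n, ∃ M, ∀ b ∈ B, |b u| ≤ M := by
    intro u
    obtain ⟨M, hM⟩ := (Bornology.forall_isBounded_image_eval_iff.2 hB u).exists_norm_le
    exact ⟨M, fun b hb => hM _ ⟨b, hb, rfl⟩⟩
  obtain ⟨M, hM⟩ := hbd v
  obtain ⟨M', hM'⟩ := hbd (vFirst n hn)
  have key : ∀ a : ℝ, 0 ≤ a → a * |d v| ≤ |x (vFirst n hn)| + |x v| + M + M' := by
    intro a ha
    have hmem : x + a • d ∈ sliceCone hn r := by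
      refine ⟨?_, fun i hi j hj hij => ?_⟩
      · have := (mem_slice hn).1 hx.1
        rw [mem_slice]
        simp only [Pi.add_apply, Pi.smul_apply, hs, ht, smul_zero, add_zero]
        exact this
      · have h1 := hx.2 i hi j hj hij
        have h2 := mul_le_mul_of_nonneg_left (hd i j hij) ha
        simp only [Pi.add_apply, Pi.smul_apply, smul_eq_mul]
        linarith
    obtain ⟨b, hb, hlin⟩ := hxB _ hmem
    have h1 := eq_of_mem_lineality hn hlin v
    simp only [Pi.sub_apply, Pi.add_apply, Pi.smul_apply, smul_eq_mul, hs, mul_zero,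
      add_zero] at h1
    have h2 : a * d v = x (vFirst n hn) - x v + b v - b (vFirst n hn) := by
      linear_combination h1
    rw [← abs_of_nonneg ha, ← abs_mul, h2]
    have h3 := hM b hb
    have h4 := hM' b hb
    rw [abs_le]
    have h5 := abs_le.1 h3
    have h6 := abs_le.1 h4
    have h7 := abs_le.1 (le_refl |x v|)
    have h8 := abs_le.1 (le_refl |x (vFirst n hn)|)
    constructor <;> linarith
  have hpos : 0 < |d v| := abs_pos.2 hv
  set C := |x (vFirst n hn)| + |x v| + M + M' with hC
  have h1 := key ((|C| + 1) / |d v|) (by positivity)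
  rw [div_mul_cancel₀ _ hpos.ne'] at h1
  have := le_abs_self C
  linarith

/-- A region of the arrangement is bounded exactly when all coordinates lie between those of `2n`
and of `1` in it: otherwise all coordinates above `v`, or all those below `v`, can be moved away
together. -/
theorem relativelyBounded_iff {x : redVerts n → ℝ}
    (hx : x ∈ complement (slice n hn) (arrP n hn)) :
    RelativelyBounded (slice n hn) (arrP n hn) (sliceCone hn (orient (Gam (redVerts n)) x)) ↔
      ∀ v, v ≠ vFirst n hn → v ≠ vLast n hn →
        orient (Gam (redVerts n)) x (vLast n hn) v ∧
          orient (Gam (redVerts n)) x v (vFirst n hn) := by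
  classical
  obtain ⟨hE, hp⟩ := (mem_complement_iff hn).1 hx
  rw [mem_slice] at hE
  set r := orient (Gam (redVerts n)) x with hr
  have hxr : x ∈ sliceCone hn r := ⟨hE, (respects_orient_iff hp).2 ⟨hp, rfl⟩⟩
  have hts : r (vLast n hn) (vFirst n hn) :=
    orient_of_adj (gam_adj_vFirst hn (even_two_mul n)).symm (by linarith)
  constructor
  · intro hb v hvs hvt
    by_contra hcon
    by_cases h : r v (vFirst n hn)
    · have h' : ¬ r (vLast n hn) v := fun h' => hcon ⟨h', h⟩
      refine not_relativelyBounded_of_direction hn hxr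
        (d := fun u => if u = v ∨ r u v then -1 else 0) ?_ ?_ ?_ (v := v) (by simp) hb
      · intro i j hij
        by_cases hj : j = v ∨ r j v
        · have hi : i = v ∨ r i v := by
            rcases hj with rfl | hj
            · exact Or.inr hij
            · exact Or.inr (orient_trans _ _ _ _ hij hj)
          rw [if_pos hi, if_pos hj]
        · rw [if_neg hj]
          split_ifs <;> norm_num
      · refine if_neg ?_
        rintro (h1 | h1)
        · exact hvs h1.symm
        · exact h' (orient_trans _ _ _ _ hts h1)
      · refine if_neg ?_
        rintro (h1 | h1)
        · exact hvt h1.symm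
        · exact h' h1
    · refine not_relativelyBounded_of_direction hn hxr
        (d := fun u => if u = v ∨ r v u then 1 else 0) ?_ ?_ ?_ (v := v) (by simp) hb
      · intro i j hij
        by_cases hi : i = v ∨ r v i
        · have hj : j = v ∨ r v j := by
            rcases hi with rfl | hi
            · exact Or.inr hij
            · exact Or.inr (orient_trans _ _ _ _ hi hij)
          rw [if_pos hi, if_pos hj]
        · rw [if_neg hi]
          split_ifs <;> norm_num
      · refine if_neg ?_
        rintro (h1 | h1)
        · exact hvs h1.symm
        · exact h h1
      · refine if_neg ?_
        rintro (h1 | h1)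
        · exact hvt h1.symm
        · exact h (orient_trans _ _ _ _ h1 hts)
  · intro h
    refine ⟨{y | ∀ v, y v ∈ Set.Icc (0 : ℝ) 1}, ?_, ?_⟩
    · refine Bornology.forall_isBounded_image_eval_iff.1 fun v => ?_
      refine (Metric.isBounded_Icc (0 : ℝ) 1).subset ?_
      rintro _ ⟨y, hy, rfl⟩
      exact hy v
    · rintro y ⟨hyE, hy⟩
      rw [mem_slice] at hyE
      refine ⟨fun v => y v - y (vLast n hn), fun v => ?_, ?_⟩
      · change y v - y (vLast n hn) ∈ Set.Icc 0 1
        by_cases hvs : v = vFirst n hn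
        · rw [hvs, hyE]
          exact ⟨zero_le_one, le_rfl⟩
        by_cases hvt : v = vLast n hn
        · rw [hvt, sub_self]
          exact ⟨le_rfl, zero_le_one⟩
        have h1 := hy _ (mem_univ _) _ (mem_univ _) (h v hvs hvt).1
        have h2 := hy _ (mem_univ _) _ (mem_univ _) (h v hvs hvt).2
        constructor <;> linarith
      · convert const_mem_lineality hn (y (vLast n hn)) using 1
        funext v
        simp

open Classical in
theorem encard_boundedRegions : (boundedRegions (slice n hn) (arrP n hn)).encard =
    #{r ∈ regionOrders (Gam (redVerts n)) | r (vLast n hn) (vFirst n hn) ∧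
      ∀ v, v ≠ vFirst n hn → v ≠ vLast n hn → r (vLast n hn) v ∧ r v (vFirst n hn)} := by
  -- Every such order is realized by a point of the slice.
  have hreal : ∀ r ∈ regionOrders (Gam (redVerts n)), r (vLast n hn) (vFirst n hn) →
      ∃ x ∈ complement (slice n hn) (arrP n hn), orient (Gam (redVerts n)) x = r := by
    intro r hr hts
    obtain ⟨y, hy, rfl⟩ := mem_regionOrders.1 hr
    have hpos : 0 < y (vFirst n hn) - y (vLast n hn) := sub_pos.2 (lt_of_orient hts)
    set a := (y (vFirst n hn) - y (vLast n hn))⁻¹ with ha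
    have ha' : 0 < a := inv_pos.2 hpos
    refine ⟨a • y, (mem_complement_iff hn).2 ⟨?_, fun i hi j hj hij h => ?_⟩,
      orient_congr fun i j _ => ?_⟩
    · rw [mem_slice]
      simp only [Pi.smul_apply, smul_eq_mul]
      rw [← mul_sub, ha, inv_mul_cancel₀ hpos.ne']
    · exact hy i hi j hj hij (mul_left_cancel₀ ha'.ne' h)
    · simp only [Pi.smul_apply, smul_eq_mul]
      exact mul_lt_mul_iff_right₀ ha'
  rw [← Set.encard_coe_eq_coe_finsetCard, ← Set.InjOn.encard_image (f := sliceCone hn)]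
  · congr 1
    ext R
    constructor
    · rintro ⟨⟨x, hx, rfl⟩, hb⟩
      have hx2 := (mem_complement_iff hn).1 hx
      have hE := (mem_slice hn).1 hx2.1
      rw [connectedComponentIn_complement hn hx] at hb ⊢
      refine ⟨_, ?_, rfl⟩
      rw [mem_coe, mem_filter]
      refine ⟨mem_regionOrders.2 ⟨x, hx2.2, rfl⟩, ?_, (relativelyBounded_iff hn hx).1 hb⟩
      exact orient_of_adj (gam_adj_vFirst hn (even_two_mul n)).symm (by linarith)
    · rintro ⟨r, hr, rfl⟩
      rw [mem_coe, mem_filter] at hr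
      obtain ⟨x, hx, rfl⟩ := hreal r hr.1 hr.2.1
      refine ⟨⟨x, hx, (connectedComponentIn_complement hn hx).symm⟩, ?_⟩
      exact (relativelyBounded_iff hn hx).2 hr.2.2
  · intro r hr r' hr' heq
    rw [mem_coe, mem_filter] at hr hr'
    obtain ⟨x, hx, rfl⟩ := hreal r hr.1 hr.2.1
    obtain ⟨x', hx', rfl⟩ := hreal r' hr'.1 hr'.2.1
    have hx2 := (mem_complement_iff hn).1 hx
    have hx2' := (mem_complement_iff hn).1 hx'
    have hmem : x ∈ sliceCone hn (orient (Gam (redVerts n)) x) :=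
      ⟨hx2.1, (respects_orient_iff hx2.2).2 ⟨hx2.2, rfl⟩⟩
    rw [heq] at hmem
    exact ((respects_orient_iff hx2'.2).1 hmem.2).2

end Bounded

end HomLinial

end

theorem corollary4p15 (n : ℕ) (hn : 3 ≤ n) :
    (Polynomial.X - 1) ^ 3 * HomLinial.charPoly (HomLinial.L n (by omega)) =
        HomLinial.charPoly (HomLinial.BondLattice (HomLinial.Gam (Finset.Icc 1 (2 * n)))) ∧
      (HomLinial.charPoly (HomLinial.L n (by omega))).eval 0 = (HomLinial.genocchi n : ℤ) ∧
      (HomLinial.charPoly (HomLinial.L n (by omega))).eval 1 =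
        (HomLinial.medianGenocchi (n - 3) : ℤ) ∧
      (HomLinial.boundedRegions (HomLinial.slice n (by omega))
        (HomLinial.arrP n (by omega))).encard = (HomLinial.medianGenocchi (n - 3) : ℕ∞) := by
  have hn2 : 2 ≤ n := by omega
  have hmed := HomLinial.medianGenocchi_eq (n - 3)
  rw [show n - 3 + 1 = n - 2 by omega] at hmed
  refine ⟨HomLinial.charPoly_L_mul hn2, ?_, ?_, ?_⟩
  · have hgen := HomLinial.genocchi_add_two (n - 2)
    rw [show n - 2 + 2 = n by omega] at hgen
    exact (HomLinial.eval_charPoly_L_eq hn2 0).trans hgen.symm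
  · exact (HomLinial.eval_charPoly_L_eq hn2 1).trans hmed.symm
  · rw [HomLinial.encard_boundedRegions hn2]
    congr 1
    exact_mod_cast (HomLinial.card_regionOrders_between hn2).trans hmed.symm
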